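/- Let $n\ge 1$ and let $\Omega\subset\mathbb R^n$ be a nonempty, open, bounded and connected set. Let $A$ be a Lipschitz, symmetric, uniformly positive definite matrix field on $\Omega$, and let $0\le c\in L^\infty(\Omega)$. Let $\mathcal L w=-\operatorname{div}(A\nabla w)+cw$, with homogeneous Dirichlet boundary conditions, understood weakly in $H^1_0(\Omega)$ (the closure of $C_c^\infty(\Omega)$ in $H^1(\Omega)$). Let $s\in(0,1)$, $\mu>0$, $u_d\in L^2(\Omega)$, and let $a,b\in L^2(\Omega)$ satisfy $a\le b$ a.e. in $\Omega$. Then $L^2(\Omega)$ has an orthonormal basis $(\varphi_k)_{k\in\mathbb N}$ of eigenfunctions, $\mathcal L\varphi_k=\lambda_k\varphi_k$ in $\Omega$, $\varphi_k=0$ on $\partial\Omega$. For any such basis, write $w_k=\int_\Omega w\varphi_k$ and put $$\mathbb H^s(\Omega)=\Big\{w\in L^2(\Omega):\ \|w\|_{\mathbb H^s(\Omega)}^2=\sum_k\lambda_k^s w_k^2<\infty\Big\},\qquad \langle \mathcal L^s u,v\rangle=\sum_k\lambda_k^s u_kv_k\quad(u,v\in\mathbb H^s(\Omega)).$$ For every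 $z$ in the dual space $\mathbb H^s(\Omega)'$ there is a unique $u=\mathbf S z\in\mathbb H^s(\Omega)$ with $\mathcal L^s u=z$, and $L^2(\Omega)$ is contained in $\mathbb H^s(\Omega)'$ through the $L^2(\Omega)$ inner product. Let $Z_{ad}=\{w\in L^2(\Omega): a\le w\le b \text{ a.e. in }\Omega\}$ and $J(u,z)=\tfrac12\|u-u_d\|_{L^2(\Omega)}^2+\tfrac{\mu}{2}\|z\|_{L^2(\Omega)}^2$. Call $(\bar u,\bar z)\in\mathbb H^s(\Omega)\times Z_{ad}$ optimal if $\bar u=\mathbf S\bar z$ and $J(\bar u,\bar z)\le J(\mathbf S z,z)$ for all $z\in Z_{ad}$. Then there is exactly one optimal pair. Moreover, a pair $(\bar u,\bar z)\in\mathbb H^s(\Omega)\times L^2(\Omega)$ is optimal (in particular $\bar z\in Z_{ad}$) if and only if $\bar u=\mathbf S\bar z$ and, with $\bar p=\mathbf S(\bar u-u_d)\in\mathbb H^s(\Omega)$, $$\bar z\in Z_{ad},\qquad (\mu\bar z+\bar p,\ z-\bar z)_{L^2(\Omega)}\ge 0\quad\text{for all } z\in Z_{ad}.$$ -/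

import Mathlib

open MeasureTheory Filter Topology
open scoped ContDiff ENNReal

namespace FracControl

noncomputable section

/-- The Euclidean space `ℝⁿ`. -/
abbrev E (n : ℕ) : Type := EuclideanSpace ℝ (Fin n)

/-- `L²(Ω)`, with Lebesgue measure on `Ω`. -/
abbrev L2 {n : ℕ} (Ω : Set (E n)) : Type := Lp ℝ 2 (volume.restrict Ω)

/-- `L²(Ω; ℝⁿ)`. -/
abbrev L2Vec {n : ℕ} (Ω : Set (E n)) : Type := Lp (E n) 2 (volume.restrict Ω)

/-- `η ∈ C_c^∞(Ω)`. -/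
def IsTestFunction {n : ℕ} (Ω : Set (E n)) (η : E n → ℝ) : Prop :=
  ContDiff ℝ ∞ η ∧ HasCompactSupport η ∧ tsupport η ⊆ Ω

/-- `g` is the weak (distributional) gradient of `w` in `Ω`. -/
def HasWeakGradient {n : ℕ} {Ω : Set (E n)} (w : L2 Ω) (g : L2Vec Ω) : Prop :=
  ∀ η : E n → ℝ, IsTestFunction Ω η → ∀ i : Fin n,
    ∫ x in Ω, w x * (gradient η x) i = - ∫ x in Ω, (g x) i * η x

/-- `w ∈ H¹₀(Ω)` with weak gradient `g`, where `H¹₀(Ω)` is the closure of `C_c^∞(Ω)` in the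
norm of `H¹(Ω)`. -/
def MemH10 {n : ℕ} {Ω : Set (E n)} (w : L2 Ω) (g : L2Vec Ω) : Prop :=
  HasWeakGradient w g ∧
  ∃ η : ℕ → E n → ℝ, (∀ m, IsTestFunction Ω (η m)) ∧
    Tendsto (fun m => eLpNorm (fun x => η m x - w x) 2 (volume.restrict Ω)) atTop (𝓝 0) ∧
    Tendsto (fun m => eLpNorm (fun x => gradient (η m) x - g x) 2 (volume.restrict Ω))
      atTop (𝓝 0)

/-- `w ∈ H¹₀(Ω)` is the weak solution of `- div (A ∇w) + c w = f` in `Ω`, `w = 0` on `∂Ω`. -/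
def IsWeakSolution {n : ℕ} {Ω : Set (E n)} (A : E n → Matrix (Fin n) (Fin n) ℝ) (c : E n → ℝ)
    (w f : L2 Ω) : Prop :=
  ∃ g : L2Vec Ω, MemH10 w g ∧ ∀ (v : L2 Ω) (h : L2Vec Ω), MemH10 v h →
    ∫ x in Ω, (((A x).mulVec (g x).ofLp) ⬝ᵥ (h x).ofLp + c x * w x * v x)
      = ∫ x in Ω, f x * v x

/-- The orthonormal basis `φ` of `L²(Ω)` consists of Dirichlet eigenfunctions of
`𝓛 w = - div (A ∇w) + c w`: `𝓛 φₖ = λₖ φₖ` in `Ω`, `φₖ = 0` on `∂Ω`. -/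
def IsEigenbasis {n : ℕ} {Ω : Set (E n)} (A : E n → Matrix (Fin n) (Fin n) ℝ) (c : E n → ℝ)
    (lam : ℕ → ℝ) (φ : HilbertBasis ℕ ℝ (L2 Ω)) : Prop :=
  ∀ k, IsWeakSolution A c (φ k) (lam k • φ k)

/-- The coefficient `wₖ = ∫_Ω w φₖ`. -/
def coeff {n : ℕ} {Ω : Set (E n)} (φ : HilbertBasis ℕ ℝ (L2 Ω)) (w : L2 Ω) (k : ℕ) : ℝ :=
  inner ℝ (φ k) w

lemma summable_weight_mul {d a b : ℕ → ℝ} (ha : Summable fun k => d k * a k ^ 2)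
    (hb : Summable fun k => d k * b k ^ 2) : Summable fun k => d k * a k * b k := by
  refine Summable.of_norm_bounded (ha.abs.add hb.abs) fun k => ?_
  rw [Real.norm_eq_abs, abs_mul, abs_mul, abs_mul, abs_mul, abs_pow, abs_pow]
  nlinarith [mul_nonneg (abs_nonneg (d k)) (sq_nonneg (|a k| - |b k|)),
    mul_nonneg (abs_nonneg (d k)) (sq_nonneg |a k|),
    mul_nonneg (abs_nonneg (d k)) (sq_nonneg |b k|)]

/-- The space `ℍˢ(Ω) = {w = ∑ₖ wₖ φₖ : ∑ₖ λₖˢ wₖ² < ∞}`. -/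
def Hs {n : ℕ} {Ω : Set (E n)} (lam : ℕ → ℝ) (φ : HilbertBasis ℕ ℝ (L2 Ω)) (s : ℝ) :
    Submodule ℝ (L2 Ω) where
  carrier := {w | Summable fun k => lam k ^ s * coeff φ w k ^ 2}
  zero_mem' := by simp [coeff]
  add_mem' := by
    intro u v hu hv
    have h := (hu.add hv).add ((summable_weight_mul hu hv).mul_left 2)
    refine h.congr fun k => ?_
    simp only [coeff, inner_add_right]
    ring
  smul_mem' := by
    intro r u hu
    refine (Summable.mul_left (r ^ 2) hu).congr fun k => ?_
    simp only [coeff, inner_smul_right]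
    ring

/-- The norm `‖w‖ = (∑ₖ λₖˢ wₖ²)^{1/2}` of `ℍˢ(Ω)`. -/
def hsNorm {n : ℕ} {Ω : Set (E n)} (lam : ℕ → ℝ) (φ : HilbertBasis ℕ ℝ (L2 Ω)) (s : ℝ)
    (w : Hs lam φ s) : ℝ :=
  √(∑' k, lam k ^ s * coeff φ w k ^ 2)

/-- The dual space of `ℍˢ(Ω)`: the linear functionals that are bounded in the norm of `ℍˢ(Ω)`. -/
def HsDual {n : ℕ} {Ω : Set (E n)} (lam : ℕ → ℝ) (φ : HilbertBasis ℕ ℝ (L2 Ω)) (s : ℝ) :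
    Set (Module.Dual ℝ (Hs lam φ s)) :=
  {l | ∃ C : ℝ, ∀ v, |l v| ≤ C * hsNorm lam φ s v}

/-- `𝓛ˢ u = ∑ₖ λₖˢ uₖ φₖ` for `u ∈ ℍˢ(Ω)`, as a functional on `ℍˢ(Ω)`:
`⟨𝓛ˢ u, v⟩ = ∑ₖ λₖˢ uₖ vₖ`. -/
def fracPower {n : ℕ} {Ω : Set (E n)} (lam : ℕ → ℝ) (φ : HilbertBasis ℕ ℝ (L2 Ω)) (s : ℝ)
    (u : Hs lam φ s) : Module.Dual ℝ (Hs lam φ s) where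
  toFun v := ∑' k, lam k ^ s * coeff φ u k * coeff φ v k
  map_add' v w := by
    rw [← (summable_weight_mul u.2 v.2).tsum_add (summable_weight_mul u.2 w.2)]
    refine tsum_congr fun k => ?_
    simp only [coeff, Submodule.coe_add, inner_add_right]
    ring
  map_smul' r v := by
    simp only [RingHom.id_apply, smul_eq_mul]
    rw [← tsum_mul_left]
    refine tsum_congr fun k => ?_
    simp only [coeff, Submodule.coe_smul, inner_smul_right]
    ring

/-- An element `z` of `L²(Ω)`, seen as the functional `v ↦ ∫_Ω z v` on `ℍˢ(Ω)`. -/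
def toDual {n : ℕ} {Ω : Set (E n)} (lam : ℕ → ℝ) (φ : HilbertBasis ℕ ℝ (L2 Ω)) (s : ℝ)
    (z : L2 Ω) : Module.Dual ℝ (Hs lam φ s) :=
  (innerₗ (L2 Ω) z).comp (Hs lam φ s).subtype

/-- `u = S l`, where `S` is the fractional control-to-state operator: `u ∈ ℍˢ(Ω)` solves the
state equation `𝓛ˢ u = l`. -/
def IsState {n : ℕ} {Ω : Set (E n)} (lam : ℕ → ℝ) (φ : HilbertBasis ℕ ℝ (L2 Ω)) (s : ℝ)
    (l : Module.Dual ℝ (Hs lam φ s)) (u : Hs lam φ s) : Prop :=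
  fracPower lam φ s u = l

/-- The set of admissible controls. -/
def Zad {n : ℕ} {Ω : Set (E n)} (a b : L2 Ω) : Set (L2 Ω) :=
  {w | ∀ᵐ x ∂(volume.restrict Ω), a x ≤ w x ∧ w x ≤ b x}

/-- The cost functional `J(u, z) = ½ ‖u - u_d‖² + (μ/2) ‖z‖²`, with norms in `L²(Ω)`. -/
def J {n : ℕ} {Ω : Set (E n)} (μ : ℝ) (ud u z : L2 Ω) : ℝ :=
  1 / 2 * ‖u - ud‖ ^ 2 + μ / 2 * ‖z‖ ^ 2

/-- `(u, z) ∈ ℍˢ(Ω) × Z_ad` is an optimal state-control pair. -/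
def IsOptimalPair {n : ℕ} {Ω : Set (E n)} (lam : ℕ → ℝ) (φ : HilbertBasis ℕ ℝ (L2 Ω)) (s : ℝ)
    (μ : ℝ) (ud a b : L2 Ω) (u : Hs lam φ s) (z : L2 Ω) : Prop :=
  z ∈ Zad a b ∧ IsState lam φ s (toDual lam φ s z) u ∧
  ∀ (u' : Hs lam φ s) (z' : L2 Ω), z' ∈ Zad a b → IsState lam φ s (toDual lam φ s z') u' →
    J μ ud u z ≤ J μ ud u' z'

end

end FracControl

/-! ### Test functions: translation estimates, Poincaré inequality and averages over cubes -/

namespace FracControl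

/-! The argument has an elliptic half, which diagonalises `𝓛`, and a Hilbert space half, which
solves the control problem in coordinates.

Elliptic half. The form `∫ A∇w·∇v + c w v` is symmetric, and the Poincaré inequality
(`exists_poincare_H10`) makes it coercive on `H¹₀(Ω)`. Its Lax–Milgram solution operator, followed
by the embedding into `L²(Ω)`, is symmetric, and compact by the Rellich theorem
(`isCompactOperator_embedding`). Its eigenvectors form the basis (`exists_isEigenbasis`). Both
Poincaré and Rellich rest on the bound of `‖η(· + h) - η‖` by `|h| ‖∇η‖` in `L²`: a translation
longer than the diameter gives Poincaré, and short ones show that averages over small cubes, which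
have finite rank, approximate the embedding in operator norm. Testing an eigenfunction with itself
yields a positive lower bound for all eigenvalues.

Control half. In any eigenbasis the state equation reads `λₖˢ uₖ = l(φₖ)`. It is solvable for every
bounded functional (`existsUnique_isState`), and on `L²(Ω)` the solution map `S` is bounded and
self-adjoint, as it divides coefficients by `λₖˢ` (`exists_controlToState`). The reduced cost `½‖Sz
- u_d‖² + (μ/2)‖z‖²` is half the squared distance from `(u_d, 0)` to `(Sz, √μ z)`, so projection
onto a closed convex set gives a minimiser. Its gradient is `μz + S(Sz - u_d)`; by self-adjointness
the adjoint state is given by `S` itself. Convexity makes the variational inequality necessary and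
sufficient, and `μ > 0` gives uniqueness. -/

lemma sq_lintegral_le_measure_univ_mul {α : Type*} [MeasurableSpace α] (ν : Measure α)
    {g : α → ℝ≥0∞} (hg : AEMeasurable g ν) :
    (∫⁻ x, g x ∂ν) ^ 2 ≤ ν Set.univ * ∫⁻ x, g x ^ 2 ∂ν := by
  have h := ENNReal.lintegral_mul_le_Lp_mul_Lq ν Real.HolderConjugate.two_two
    (aemeasurable_const (b := (1 : ℝ≥0∞))) hg
  simp only [Pi.mul_apply, one_mul, ENNReal.one_rpow, lintegral_const] at h
  have h2 := pow_le_pow_left' h 2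
  rw [mul_pow, ← ENNReal.rpow_natCast, ← ENNReal.rpow_natCast (_ ^ (1 / 2 : ℝ)),
    ← ENNReal.rpow_natCast (_ ^ (1 / 2 : ℝ)), ← ENNReal.rpow_mul, ← ENNReal.rpow_mul] at h2
  simpa using h2

lemma enorm_integral_sq_le {α : Type*} [MeasurableSpace α] (ν : Measure α) {f : α → ℝ}
    (hf : AEMeasurable f ν) :
    ‖∫ x, f x ∂ν‖ₑ ^ 2 ≤ ν Set.univ * ∫⁻ x, ‖f x‖ₑ ^ 2 ∂ν :=
  (pow_le_pow_left' (enorm_integral_le_lintegral_enorm f) 2).trans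
    (sq_lintegral_le_measure_univ_mul ν hf.enorm)

variable {n : ℕ} {η : E n → ℝ}

lemma enorm_gradient (x : E n) : ‖gradient η x‖ₑ = ‖fderiv ℝ η x‖ₑ := by
  simp [gradient, enorm_eq_nnnorm]

lemma continuous_gradient (hη : ContDiff ℝ 1 η) : Continuous (gradient η) :=
  (InnerProductSpace.toDual ℝ (E n)).symm.continuous.comp (hη.continuous_fderiv one_ne_zero)

/-- Fundamental theorem of calculus along the segment from `x` to `x + h`, then Cauchy–Schwarz on an
interval of length one. Working in `ℝ≥0∞` lets Tonelli apply afterwards without integrability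
checks. -/
lemma enorm_sub_translate_sq_le (hη : ContDiff ℝ 1 η) (x h : E n) :
    ‖η (x + h) - η x‖ₑ ^ 2
      ≤ ∫⁻ t in Set.Ioc (0 : ℝ) 1, ‖h‖ₑ ^ 2 * ‖gradient η (x + t • h)‖ₑ ^ 2 := by
  have hcont : Continuous fun t : ℝ => fderiv ℝ η (x + t • h) h := by
    have := hη.continuous_fderiv one_ne_zero
    fun_prop
  have hd : ∀ t : ℝ, HasDerivAt (fun t : ℝ => η (x + t • h)) (fderiv ℝ η (x + t • h) h) t := by
    intro t
    have h1 : HasDerivAt (fun t : ℝ => x + t • h) h t := by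
      simpa using ((hasDerivAt_id t).smul_const h).const_add x
    exact ((hη.differentiable one_ne_zero).differentiableAt.hasFDerivAt).comp_hasDerivAt t h1
  have hftc := intervalIntegral.integral_eq_sub_of_hasDerivAt (a := 0) (b := 1)
    (fun t _ => hd t) (hcont.intervalIntegrable _ _)
  rw [intervalIntegral.integral_of_le zero_le_one] at hftc
  simp only [one_smul, zero_smul, add_zero] at hftc
  rw [← hftc]
  refine (enorm_integral_sq_le _ hcont.measurable.aemeasurable).trans ?_
  simp only [Measure.restrict_apply MeasurableSet.univ, Set.univ_inter, Real.volume_Ioc, sub_zero,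
    ENNReal.ofReal_one, one_mul]
  refine lintegral_mono fun t => ?_
  rw [enorm_gradient, ← mul_pow, mul_comm]
  exact pow_le_pow_left' (ContinuousLinearMap.le_opENorm _ _) 2

/-- The `L²` modulus of continuity of a function is controlled by its gradient. -/
lemma lintegral_enorm_sub_translate_sq_le (hη : ContDiff ℝ 1 η) (h : E n) :
    ∫⁻ x, ‖η (x + h) - η x‖ₑ ^ 2 ≤ ‖h‖ₑ ^ 2 * ∫⁻ x, ‖gradient η x‖ₑ ^ 2 := by
  have hg := continuous_gradient hη
  calc ∫⁻ x, ‖η (x + h) - η x‖ₑ ^ 2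
      ≤ ∫⁻ x, ∫⁻ t in Set.Ioc (0 : ℝ) 1, ‖h‖ₑ ^ 2 * ‖gradient η (x + t • h)‖ₑ ^ 2 :=
        lintegral_mono fun x => enorm_sub_translate_sq_le hη x h
    _ = ∫⁻ t in Set.Ioc (0 : ℝ) 1, ∫⁻ x, ‖h‖ₑ ^ 2 * ‖gradient η (x + t • h)‖ₑ ^ 2 := by
        refine lintegral_lintegral_swap (Measurable.aemeasurable ?_)
        have : Continuous fun p : E n × ℝ => gradient η (p.1 + p.2 • h) := by fun_prop
        exact (this.measurable.enorm.pow_const 2).const_mul _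
    _ = ∫⁻ t in Set.Ioc (0 : ℝ) 1, ‖h‖ₑ ^ 2 * ∫⁻ x, ‖gradient η x‖ₑ ^ 2 := by
        refine lintegral_congr fun t => ?_
        rw [lintegral_const_mul, lintegral_add_right_eq_self (fun x => ‖gradient η x‖ₑ ^ 2)]
        have : Continuous fun x : E n => gradient η (x + t • h) := by fun_prop
        exact this.measurable.enorm.pow_const 2
    _ = ‖h‖ₑ ^ 2 * ∫⁻ x, ‖gradient η x‖ₑ ^ 2 := by simp

variable {Ω : Set (E n)}

lemma IsTestFunction.eq_zero (hη : IsTestFunction Ω η) {x : E n} (hx : x ∉ Ω) : η x = 0 :=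
  image_eq_zero_of_notMem_tsupport fun h => hx (hη.2.2 h)

lemma IsTestFunction.contDiff_one (hη : IsTestFunction Ω η) : ContDiff ℝ 1 η :=
  hη.1.of_le (by exact_mod_cast le_top)

lemma gradient_eq_zero_of_notMem_tsupport {x : E n} (hx : x ∉ tsupport η) : gradient η x = 0 := by
  have : fderiv ℝ η x = 0 := by
    by_contra h
    exact hx (support_fderiv_subset ℝ h)
  simp [gradient, this]

lemma IsTestFunction.hasCompactSupport_gradient (hη : IsTestFunction Ω η) :
    HasCompactSupport (gradient η) :=
  HasCompactSupport.intro hη.2.1 fun _ hx => gradient_eq_zero_of_notMem_tsupport hx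

lemma IsTestFunction.setLIntegral_enorm_gradient_sq (hη : IsTestFunction Ω η) :
    ∫⁻ x in Ω, ‖gradient η x‖ₑ ^ 2 = ∫⁻ x, ‖gradient η x‖ₑ ^ 2 := by
  refine setLIntegral_eq_of_support_subset fun x hx => hη.2.2 ?_
  by_contra h
  exact hx (by simp [gradient_eq_zero_of_notMem_tsupport h])

/-- The Poincaré inequality for test functions. -/
lemma exists_poincare (hn : 1 ≤ n) (hΩ : IsOpen Ω) (hb : Bornology.IsBounded Ω) :
    ∃ R : NNReal, ∀ η, IsTestFunction Ω η →
      ∫⁻ x in Ω, ‖η x‖ₑ ^ 2 ≤ (R : ℝ≥0∞) ^ 2 * ∫⁻ x in Ω, ‖gradient η x‖ₑ ^ 2 := by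
  obtain ⟨C, hC⟩ := Metric.isBounded_iff.1 hb
  -- A vector longer than the diameter moves every point of `Ω` out of `Ω`, so on `Ω` the difference
  -- `η (x + h) - η x` is just `-η x`.
  obtain ⟨h, hh⟩ : ∃ h : E n, C < ‖h‖ := by
    refine ⟨EuclideanSpace.single ⟨0, hn⟩ (|C| + 1), ?_⟩
    rw [PiLp.norm_single, Real.norm_eq_abs, abs_of_pos (by positivity)]
    linarith [le_abs_self C]
  refine ⟨‖h‖₊, fun η hη => ?_⟩
  rw [hη.setLIntegral_enorm_gradient_sq]
  refine le_trans ?_ (lintegral_enorm_sub_translate_sq_le hη.contDiff_one h)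
  refine le_trans (setLIntegral_mono_ae' hΩ.measurableSet (ae_of_all _ fun x hx => ?_))
    (setLIntegral_le_lintegral Ω _)
  have : x + h ∉ Ω := fun hx' => by
    have := hC hx' hx
    rw [dist_eq_norm, add_sub_cancel_left] at this
    linarith
  simp [hη.eq_zero this]

/-- The half-open cube of side `δ` with integer index `k`. -/
def cell (δ : ℝ) (k : Fin n → ℤ) : Set (E n) :=
  {x | ∀ i, x i ∈ Set.Ico (k i * δ) ((k i + 1) * δ)}

lemma cell_eq_preimage (δ : ℝ) (k : Fin n → ℤ) :
    cell δ k = (MeasurableEquiv.toLp 2 (Fin n → ℝ)).symm ⁻¹'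
      Set.univ.pi fun i => Set.Ico (k i * δ) ((k i + 1) * δ) := by
  ext x
  simp [cell]

lemma measurableSet_cell (δ : ℝ) (k : Fin n → ℤ) : MeasurableSet (cell δ k) := by
  rw [cell_eq_preimage]
  exact (MeasurableEquiv.measurable _) (MeasurableSet.univ_pi fun i => measurableSet_Ico)

lemma volume_cell (δ : ℝ) (k : Fin n → ℤ) : volume (cell δ k) = ENNReal.ofReal δ ^ n := by
  rw [cell_eq_preimage, (EuclideanSpace.volume_preserving_symm_measurableEquiv_toLp
    (Fin n)).measure_preimage_equiv, Real.volume_pi_Ico]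
  simp [add_mul]

/-- The open cube of side `2 δ` centred at the origin. -/
def centredCube (n : ℕ) (δ : ℝ) : Set (E n) := {x | ∀ i, x i ∈ Set.Ioo (-δ) δ}

lemma centredCube_eq_preimage (δ : ℝ) :
    centredCube n δ = (MeasurableEquiv.toLp 2 (Fin n → ℝ)).symm ⁻¹'
      Set.univ.pi fun _ => Set.Ioo (-δ) δ := by
  ext x
  simp [centredCube]

lemma measurableSet_centredCube (δ : ℝ) : MeasurableSet (centredCube n δ) := by
  rw [centredCube_eq_preimage]
  exact (MeasurableEquiv.measurable _) (MeasurableSet.univ_pi fun i => measurableSet_Ioo)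

lemma volume_centredCube (δ : ℝ) :
    volume (centredCube n δ) = 2 ^ n * ENNReal.ofReal δ ^ n := by
  rw [centredCube_eq_preimage, (EuclideanSpace.volume_preserving_symm_measurableEquiv_toLp
    (Fin n)).measure_preimage_equiv, Real.volume_pi_Ioo]
  simp [← two_mul, ENNReal.ofReal_mul, mul_pow]

lemma enorm_sq_le_of_mem_centredCube {δ : ℝ} {h : E n} (hh : h ∈ centredCube n δ) :
    ‖h‖ₑ ^ 2 ≤ n * ENNReal.ofReal δ ^ 2 := by
  rcases Nat.eq_zero_or_pos n with rfl | hn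
  · simp [Subsingleton.elim h 0]
  have hδ : 0 < δ := by
    have := hh ⟨0, hn⟩
    rw [Set.mem_Ioo] at this
    linarith
  have h1 : ‖h‖ ^ 2 ≤ n * δ ^ 2 := by
    rw [EuclideanSpace.norm_sq_eq]
    calc ∑ i, ‖h i‖ ^ 2 ≤ ∑ i : Fin n, δ ^ 2 := by
          refine Finset.sum_le_sum fun i _ => pow_le_pow_left₀ (norm_nonneg _) ?_ 2
          exact abs_le.2 ⟨(hh i).1.le, (hh i).2.le⟩
      _ = n * δ ^ 2 := by simp
  rw [← ofReal_norm, ← ENNReal.ofReal_pow (norm_nonneg _), ← ENNReal.ofReal_pow hδ.le,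
    ← ENNReal.ofReal_natCast, ← ENNReal.ofReal_mul (by positivity)]
  exact ENNReal.ofReal_le_ofReal h1

/-- The left side is the average of `η x - η y` over `y` in the cell, to which Cauchy–Schwarz
applies. Since `y - x` stays in the centred cube, the bound does not depend on the cell and can be
integrated over all `x` at once. -/
lemma enorm_sub_average_cell_sq_le {δ : ℝ} (hδ : 0 < δ) (hη : Continuous η)
    (hs : HasCompactSupport η) {k : Fin n → ℤ} {x : E n} (hx : x ∈ cell δ k) :
    ‖η x - (δ ^ n)⁻¹ * ∫ y in cell δ k, η y‖ₑ ^ 2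
      ≤ (ENNReal.ofReal δ ^ n)⁻¹ * ∫⁻ h in centredCube n δ, ‖η (x + h) - η x‖ₑ ^ 2 := by
  have hpos : 0 < δ ^ n := pow_pos hδ n
  have hV : volume (cell δ k) = ENNReal.ofReal (δ ^ n) := by
    rw [volume_cell, ENNReal.ofReal_pow hδ.le]
  have : IsFiniteMeasure (volume.restrict (cell δ k)) := ⟨by simp [hV]⟩
  have hV0 : ENNReal.ofReal (δ ^ n) ≠ 0 := by simpa using hpos
  have h1 : η x - (δ ^ n)⁻¹ * ∫ y in cell δ k, η y
      = (δ ^ n)⁻¹ * ∫ y in cell δ k, (η x - η y) := by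
    rw [integral_sub (integrable_const _) (hη.integrable_of_hasCompactSupport hs).integrableOn,
      setIntegral_const, Measure.real, hV, ENNReal.toReal_ofReal hpos.le]
    simp only [smul_eq_mul]
    field_simp
  have h2 := enorm_integral_sq_le (volume.restrict (cell δ k))
    (f := fun y => η x - η y) (by fun_prop)
  rw [Measure.restrict_apply MeasurableSet.univ, Set.univ_inter, hV] at h2
  rw [h1, enorm_mul, mul_pow, enorm_inv hpos.ne', Real.enorm_eq_ofReal hpos.le,
    ← ENNReal.ofReal_pow hδ.le]
  have h3 : ∫⁻ y in cell δ k, ‖η x - η y‖ₑ ^ 2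
      ≤ ∫⁻ h in centredCube n δ, ‖η (x + h) - η x‖ₑ ^ 2 := by
    rw [← lintegral_indicator (measurableSet_cell δ k),
      ← lintegral_indicator (measurableSet_centredCube δ),
      ← lintegral_add_left_eq_self _ x]
    refine lintegral_mono fun h => ?_
    by_cases hh : x + h ∈ cell δ k
    · have : h ∈ centredCube n δ := fun i => by
        have h4 := hh i
        have h5 := hx i
        simp only [PiLp.add_apply, Set.mem_Ico] at h4 h5
        constructor <;> linarith
      rw [Set.indicator_of_mem hh, Set.indicator_of_mem this, ← enorm_neg, neg_sub]
    · simp [Set.indicator_of_notMem hh]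
  calc (ENNReal.ofReal (δ ^ n))⁻¹ ^ 2 * ‖∫ y in cell δ k, (η x - η y)‖ₑ ^ 2
      ≤ (ENNReal.ofReal (δ ^ n))⁻¹ ^ 2 *
        (ENNReal.ofReal (δ ^ n) * ∫⁻ y in cell δ k, ‖η x - η y‖ₑ ^ 2) := by gcongr
    _ = (ENNReal.ofReal (δ ^ n))⁻¹ * ∫⁻ y in cell δ k, ‖η x - η y‖ₑ ^ 2 := by
        rw [← mul_assoc, pow_two, mul_assoc (ENNReal.ofReal (δ ^ n))⁻¹,
          ENNReal.inv_mul_cancel hV0 ENNReal.ofReal_ne_top, mul_one]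
    _ ≤ _ := by gcongr

/-- Tonelli reduces this to the translation estimate for each fixed `h`. The cube has volume
`(2δ)ⁿ`, whence `2 ^ n`, and `|h|² ≤ n δ²` on it. -/
lemma lintegral_translates_le {δ : ℝ} (hδ : 0 < δ) (hη : ContDiff ℝ 1 η) :
    ∫⁻ x, (ENNReal.ofReal δ ^ n)⁻¹ * ∫⁻ h in centredCube n δ, ‖η (x + h) - η x‖ₑ ^ 2
      ≤ 2 ^ n * n * ENNReal.ofReal δ ^ 2 * ∫⁻ x, ‖gradient η x‖ₑ ^ 2 := by
  have hc := hη.continuous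
  have hm : Measurable fun p : E n × E n => ‖η (p.1 + p.2) - η p.1‖ₑ ^ 2 := by
    have : Continuous fun p : E n × E n => η (p.1 + p.2) - η p.1 := by fun_prop
    exact this.measurable.enorm.pow_const 2
  have h0 : ENNReal.ofReal δ ^ n ≠ 0 := pow_ne_zero _ (by simpa using hδ)
  have ht : ENNReal.ofReal δ ^ n ≠ ⊤ := ENNReal.pow_ne_top ENNReal.ofReal_ne_top
  rw [lintegral_const_mul _ hm.lintegral_prod_right', lintegral_lintegral_swap hm.aemeasurable]
  calc (ENNReal.ofReal δ ^ n)⁻¹ * ∫⁻ h in centredCube n δ, ∫⁻ x, ‖η (x + h) - η x‖ₑ ^ 2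
      ≤ (ENNReal.ofReal δ ^ n)⁻¹ * ∫⁻ h in centredCube n δ,
          n * ENNReal.ofReal δ ^ 2 * ∫⁻ x, ‖gradient η x‖ₑ ^ 2 := by
        refine mul_le_mul_right (setLIntegral_mono_ae' (measurableSet_centredCube δ)
          (ae_of_all _ fun h hh => ?_)) _
        refine (lintegral_enorm_sub_translate_sq_le hη h).trans ?_
        gcongr
        exact enorm_sq_le_of_mem_centredCube hh
    _ = ((ENNReal.ofReal δ ^ n)⁻¹ * ENNReal.ofReal δ ^ n) *
          (2 ^ n * n * ENNReal.ofReal δ ^ 2 * ∫⁻ x, ‖gradient η x‖ₑ ^ 2) := by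
        rw [setLIntegral_const, volume_centredCube]
        ring
    _ = _ := by rw [ENNReal.inv_mul_cancel h0 ht, one_mul]

end FracControl

/-! ### The space `H¹₀(Ω)` as a closed graph -/

namespace FracControl

variable {n : ℕ} {Ω : Set (E n)} {η : E n → ℝ}

lemma enorm_sq_eq_lintegral {α F : Type*} [MeasurableSpace α] {ν : Measure α}
    [NormedAddCommGroup F] (f : Lp F 2 ν) : ‖f‖ₑ ^ 2 = ∫⁻ x, ‖f x‖ₑ ^ 2 ∂ν := by
  have := eLpNorm_nnreal_pow_eq_lintegral (μ := ν) (f := f) (p := 2) two_ne_zero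
  rw [Lp.enorm_def]
  simpa using this

lemma IsTestFunction.memLp (hη : IsTestFunction Ω η) : MemLp η 2 (volume.restrict Ω) :=
  (hη.1.continuous.memLp_of_hasCompactSupport hη.2.1).restrict Ω

lemma IsTestFunction.memLp_gradient (hη : IsTestFunction Ω η) :
    MemLp (gradient η) 2 (volume.restrict Ω) :=
  ((continuous_gradient hη.contDiff_one).memLp_of_hasCompactSupport
    hη.hasCompactSupport_gradient).restrict Ω

lemma IsTestFunction.add {ζ : E n → ℝ} (hη : IsTestFunction Ω η) (hζ : IsTestFunction Ω ζ) :
    IsTestFunction Ω (η + ζ) :=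
  ⟨hη.1.add hζ.1, hη.2.1.add hζ.2.1,
    (tsupport_add η ζ).trans (Set.union_subset hη.2.2 hζ.2.2)⟩

lemma IsTestFunction.smul (hη : IsTestFunction Ω η) (r : ℝ) : IsTestFunction Ω (r • η) :=
  ⟨hη.1.const_smul r, hη.2.1.smul_left, (tsupport_smul_subset_right (fun _ => r) η).trans hη.2.2⟩

lemma isTestFunction_zero : IsTestFunction Ω (0 : E n → ℝ) :=
  ⟨contDiff_const, HasCompactSupport.zero, by simp [tsupport]⟩

lemma gradient_add {ζ : E n → ℝ} (hη : ContDiff ℝ 1 η) (hζ : ContDiff ℝ 1 ζ) (x : E n) :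
    gradient (η + ζ) x = gradient η x + gradient ζ x := by
  rw [gradient, fderiv_add (hη.differentiable one_ne_zero x) (hζ.differentiable one_ne_zero x),
    map_add]
  rfl

lemma gradient_smul (hη : ContDiff ℝ 1 η) (r : ℝ) (x : E n) :
    gradient (r • η) x = r • gradient η x := by
  rw [gradient, fderiv_const_smul (hη.differentiable one_ne_zero x), map_smulₛₗ]
  simp [gradient]

lemma gradient_zero (x : E n) : gradient (0 : E n → ℝ) x = 0 := by
  simp [gradient]

lemma gradient_apply (x : E n) (i : Fin n) :
    gradient η x i = fderiv ℝ η x (EuclideanSpace.single i 1) := by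
  rw [← inner_gradient_left (𝕜 := ℝ), EuclideanSpace.inner_single_right]
  simp

/-- Pairs of a function in `L²(Ω)` and a vector field in `L²(Ω; ℝⁿ)`. -/
abbrev L2Pair (Ω : Set (E n)) : Type := WithLp 2 (L2 Ω × L2Vec Ω)

/-- The graph of the gradient on test functions. -/
noncomputable def testGraph (Ω : Set (E n)) : Submodule ℝ (L2Pair Ω) where
  carrier := {p | ∃ η, IsTestFunction Ω η ∧ p.fst =ᵐ[volume.restrict Ω] η ∧
    p.snd =ᵐ[volume.restrict Ω] gradient η}
  zero_mem' := by
    refine ⟨0, isTestFunction_zero, Lp.coeFn_zero _ _ _, ?_⟩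
    filter_upwards [Lp.coeFn_zero (E n) 2 (volume.restrict Ω)] with x hx
    rw [WithLp.zero_snd, hx, gradient_zero, Pi.zero_apply]
  add_mem' := by
    rintro p q ⟨η, hη, h1, h2⟩ ⟨ζ, hζ, h3, h4⟩
    refine ⟨η + ζ, hη.add hζ, (Lp.coeFn_add _ _).trans (h1.add h3), ?_⟩
    filter_upwards [Lp.coeFn_add p.snd q.snd, h2, h4] with x h5 h2 h4
    rw [WithLp.add_snd, h5, gradient_add hη.contDiff_one hζ.contDiff_one, Pi.add_apply, h2, h4]
  smul_mem' := by
    rintro r p ⟨η, hη, h1, h2⟩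
    refine ⟨r • η, hη.smul r, (Lp.coeFn_smul _ _).trans (h1.const_smul r), ?_⟩
    filter_upwards [Lp.coeFn_smul r p.snd, h2] with x h5 h2
    rw [WithLp.smul_snd, h5, gradient_smul hη.contDiff_one, Pi.smul_apply, h2]

/-- The Hilbert space `H¹₀(Ω)`, realised as a closed space of pairs `(w, ∇w)`. -/
noncomputable def H10 (Ω : Set (E n)) : Submodule ℝ (L2Pair Ω) := (testGraph Ω).topologicalClosure

lemma isClosed_H10 : IsClosed (H10 Ω : Set (L2Pair Ω)) :=
  Submodule.isClosed_topologicalClosure _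

instance : CompleteSpace (H10 Ω) := isClosed_H10.completeSpace_coe

/-- A closed condition that holds for test functions holds in `H¹₀(Ω)`. -/
lemma H10_induction {P : L2Pair Ω → Prop} (hP : IsClosed {p | P p})
    (h : ∀ p : L2Pair Ω, ∀ η, IsTestFunction Ω η → p.fst =ᵐ[volume.restrict Ω] η →
      p.snd =ᵐ[volume.restrict Ω] gradient η → P p) {p : L2Pair Ω} (hp : p ∈ H10 Ω) : P p :=
  closure_minimal (s := (testGraph Ω : Set (L2Pair Ω)))
    (fun _ ⟨η, hη, h1, h2⟩ => h _ η hη h1 h2) hP hp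

lemma IsTestFunction.mem_H10 (hη : IsTestFunction Ω η) :
    WithLp.toLp 2 (hη.memLp.toLp η, hη.memLp_gradient.toLp (gradient η)) ∈ H10 Ω :=
  Submodule.le_topologicalClosure _
    ⟨η, hη, hη.memLp.coeFn_toLp, hη.memLp_gradient.coeFn_toLp⟩

lemma memLp_gradient_apply (hη : IsTestFunction Ω η) (i : Fin n) :
    MemLp (fun x => gradient η x i) 2 (volume.restrict Ω) :=
  hη.memLp_gradient.eval_piLp i

lemma memLp_smul_single (hη : IsTestFunction Ω η) (i : Fin n) :
    MemLp (fun x => η x • EuclideanSpace.single i (1 : ℝ)) 2 (volume.restrict Ω) := by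
  refine hη.memLp.of_le ?_ (ae_of_all _ fun x => ?_)
  · exact (hη.1.continuous.smul continuous_const).aestronglyMeasurable
  · simp [norm_smul]

/-- Pairing with a fixed element of `L²(Ω)` is continuous in `w`; together with the next pairing,
this makes the weak gradient identity a closed condition. -/
lemma integral_mul_gradient_eq_inner (hη : IsTestFunction Ω η) (i : Fin n) (w : L2 Ω) :
    ∫ x in Ω, w x * gradient η x i = inner ℝ ((memLp_gradient_apply hη i).toLp _) w := by
  rw [L2.inner_def]
  refine integral_congr_ae ?_
  filter_upwards [(memLp_gradient_apply hη i).coeFn_toLp] with x hx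
  rw [hx]
  simp

lemma integral_apply_mul_eq_inner (hη : IsTestFunction Ω η) (i : Fin n) (g : L2Vec Ω) :
    ∫ x in Ω, (g x) i * η x = inner ℝ ((memLp_smul_single hη i).toLp _) g := by
  rw [L2.inner_def]
  refine integral_congr_ae ?_
  filter_upwards [(memLp_smul_single hη i).coeFn_toLp] with x hx
  rw [hx, real_inner_smul_left, EuclideanSpace.inner_single_left]
  simp [mul_comm]

lemma integral_mul_gradient_test {ζ : E n → ℝ} (hζ : IsTestFunction Ω ζ)
    (hη : IsTestFunction Ω η) (i : Fin n) :
    ∫ x in Ω, ζ x * gradient η x i = - ∫ x in Ω, gradient ζ x i * η x := by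
  have hcη := hη.1.continuous
  have hcζ := hζ.1.continuous
  have hgη := continuous_gradient hη.contDiff_one
  have hgζ := continuous_gradient hζ.contDiff_one
  -- Both integrands vanish outside `Ω`, so integration by parts takes place on the whole space,
  -- with no boundary term and no regularity of `∂Ω`.
  rw [setIntegral_eq_integral_of_forall_compl_eq_zero fun x hx => by simp [hζ.eq_zero hx],
    setIntegral_eq_integral_of_forall_compl_eq_zero fun x hx => by simp [hη.eq_zero hx]]
  simp only [gradient_apply]
  refine integral_mul_fderiv_eq_neg_fderiv_mul_of_integrable ?_ ?_ ?_
    (fun x _ => hζ.contDiff_one.differentiable one_ne_zero x)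
    (fun x _ => hη.contDiff_one.differentiable one_ne_zero x)
  · simp only [← gradient_apply]
    exact Continuous.integrable_of_hasCompactSupport (by fun_prop) hη.2.1.mul_left
  · simp only [← gradient_apply]
    exact Continuous.integrable_of_hasCompactSupport (by fun_prop) hζ.2.1.mul_right
  · exact Continuous.integrable_of_hasCompactSupport (by fun_prop) hζ.2.1.mul_right

lemma hasWeakGradient_of_mem_H10 {p : L2Pair Ω} (hp : p ∈ H10 Ω) :
    HasWeakGradient p.fst p.snd := by
  intro η hη i
  refine H10_induction (P := fun p => ∫ x in Ω, p.fst x * gradient η x i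
    = - ∫ x in Ω, (p.snd x) i * η x) ?_ (fun p ζ hζ h1 h2 => ?_) hp
  · simp only [integral_mul_gradient_eq_inner hη, integral_apply_mul_eq_inner hη]
    have h1 := WithLp.continuous_fst 2 (L2 Ω) (L2Vec Ω)
    have h2 := WithLp.continuous_snd 2 (L2 Ω) (L2Vec Ω)
    exact isClosed_eq (by fun_prop) (by fun_prop)
  · have e1 : ∫ x in Ω, p.fst x * gradient η x i = ∫ x in Ω, ζ x * gradient η x i :=
      integral_congr_ae (by filter_upwards [h1] with x hx using by rw [hx])
    have e2 : ∫ x in Ω, (p.snd x) i * η x = ∫ x in Ω, gradient ζ x i * η x :=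
      integral_congr_ae (by filter_upwards [h2] with x hx using by rw [hx])
    rw [e1, e2, integral_mul_gradient_test hζ hη]

/-- `H¹₀(Ω)` is exactly the closure of the graph of the gradient on test functions. -/
lemma memH10_iff {w : L2 Ω} {g : L2Vec Ω} : MemH10 w g ↔ WithLp.toLp 2 (w, g) ∈ H10 Ω := by
  constructor
  -- The weak gradient clause is redundant: it passes to the limit from test functions, as the
  -- converse direction shows.
  · rintro ⟨-, η, hη, h1, h2⟩
    have h3 : Tendsto (fun m => (hη m).memLp.toLp (η m)) atTop (𝓝 w) := by
      rw [Lp.tendsto_Lp_iff_tendsto_eLpNorm']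
      refine h1.congr fun m => eLpNorm_congr_ae ?_
      filter_upwards [(hη m).memLp.coeFn_toLp] with x hx
      rw [Pi.sub_apply, hx]
    have h4 : Tendsto (fun m => (hη m).memLp_gradient.toLp (gradient (η m))) atTop (𝓝 g) := by
      rw [Lp.tendsto_Lp_iff_tendsto_eLpNorm']
      refine h2.congr fun m => eLpNorm_congr_ae ?_
      filter_upwards [(hη m).memLp_gradient.coeFn_toLp] with x hx
      rw [Pi.sub_apply, hx]
    exact isClosed_H10.mem_of_tendsto
      (((WithLp.prod_continuous_toLp 2 (L2 Ω) (L2Vec Ω)).tendsto (w, g)).comp (h3.prodMk_nhds h4))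
      (Eventually.of_forall fun m => (hη m).mem_H10)
  · intro h
    refine ⟨hasWeakGradient_of_mem_H10 h, ?_⟩
    obtain ⟨p, hp, hlim⟩ := mem_closure_iff_seq_limit.1 h
    choose η hη h1 h2 using hp
    refine ⟨η, hη, ?_, ?_⟩
    · have := ((WithLp.continuous_fst 2 (L2 Ω) (L2Vec Ω)).tendsto _).comp hlim
      refine ((Lp.tendsto_Lp_iff_tendsto_eLpNorm' _ _).1 this).congr fun m => eLpNorm_congr_ae ?_
      filter_upwards [h1 m] with x hx
      simp [hx]
    · have := ((WithLp.continuous_snd 2 (L2 Ω) (L2Vec Ω)).tendsto _).comp hlim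
      refine ((Lp.tendsto_Lp_iff_tendsto_eLpNorm' _ _).1 this).congr fun m => eLpNorm_congr_ae ?_
      filter_upwards [h2 m] with x hx
      simp [hx]

lemma memH10_fst_snd (p : H10 Ω) : MemH10 (p : L2Pair Ω).fst (p : L2Pair Ω).snd :=
  memH10_iff.2 p.2

/-- The Poincaré inequality in `H¹₀(Ω)`. -/
lemma exists_poincare_H10 (hn : 1 ≤ n) (hΩ : IsOpen Ω) (hb : Bornology.IsBounded Ω) :
    ∃ R : NNReal, ∀ p ∈ H10 Ω, ‖p.fst‖ ≤ R * ‖p.snd‖ := by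
  obtain ⟨R, hR⟩ := exists_poincare hn hΩ hb
  refine ⟨R, fun p hp => H10_induction (P := fun p => ‖p.fst‖ ≤ R * ‖p.snd‖) ?_
    (fun p η hη h1 h2 => ?_) hp⟩
  · have h1 := WithLp.continuous_fst 2 (L2 Ω) (L2Vec Ω)
    have h2 := WithLp.continuous_snd 2 (L2 Ω) (L2Vec Ω)
    exact isClosed_le (by fun_prop) (by fun_prop)
  · have h : ‖p.fst‖ₑ ^ 2 ≤ (R * ‖p.snd‖ₑ) ^ 2 := by
      rw [mul_pow, enorm_sq_eq_lintegral, enorm_sq_eq_lintegral]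
      convert hR η hη using 1
      · exact lintegral_congr_ae (by filter_upwards [h1] with x hx using by rw [hx])
      · congr 1
        exact lintegral_congr_ae (by filter_upwards [h2] with x hx using by rw [hx])
    have h := (ENNReal.pow_le_pow_left_iff two_ne_zero).1 h
    simp only [enorm_eq_nnnorm] at h
    exact_mod_cast h

end FracControl

/-! ### Rellich's theorem by averaging over cells -/

namespace FracControl

variable {n : ℕ} {Ω : Set (E n)} {η : E n → ℝ}

/-- The indices of the cells of side `δ` that meet the ball of radius `R`. -/
noncomputable def cellIndices (n : ℕ) (R δ : ℝ) : Finset (Fin n → ℤ) :=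
  Fintype.piFinset fun _ => Finset.Icc ⌊-R / δ⌋ ⌊R / δ⌋

/-- The index of the cell of side `δ` that contains `x`. -/
noncomputable def cellIndex (δ : ℝ) (x : E n) : Fin n → ℤ := fun i => ⌊x i / δ⌋

lemma mem_cell_iff {δ : ℝ} (hδ : 0 < δ) {x : E n} {k : Fin n → ℤ} :
    x ∈ cell δ k ↔ cellIndex δ x = k := by
  simp only [cell, cellIndex, Set.mem_ofPred_eq, Set.mem_Ico, funext_iff, Int.floor_eq_iff,
    le_div_iff₀ hδ, div_lt_iff₀ hδ]

lemma cellIndex_mem {R δ : ℝ} (hδ : 0 < δ) {x : E n} (hx : ‖x‖ ≤ R) :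
    cellIndex δ x ∈ cellIndices n R δ := by
  refine Fintype.mem_piFinset.2 fun i => Finset.mem_Icc.2 ?_
  have h := abs_le.1 ((PiLp.norm_apply_le x i).trans hx)
  exact ⟨Int.floor_le_floor (div_le_div_of_nonneg_right h.1 hδ.le),
    Int.floor_le_floor (div_le_div_of_nonneg_right h.2 hδ.le)⟩

lemma volume_restrict_cell_ne_top (Ω : Set (E n)) (δ : ℝ) (k : Fin n → ℤ) :
    volume.restrict Ω (cell δ k) ≠ ⊤ :=
  ne_top_of_le_ne_top (by rw [volume_cell]; exact ENNReal.pow_ne_top ENNReal.ofReal_ne_top)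
    (Measure.restrict_apply_le Ω (cell δ k))

/-- The indicator function of a cell, in `L²(Ω)`. -/
noncomputable def cellIndicator (Ω : Set (E n)) (δ : ℝ) (k : Fin n → ℤ) : L2 Ω :=
  indicatorConstLp 2 (measurableSet_cell δ k) (volume_restrict_cell_ne_top Ω δ k) (1 : ℝ)

/-- Averaging over the cells of side `δ`. -/
noncomputable def cellAverage (Ω : Set (E n)) (R δ : ℝ) : L2 Ω →L[ℝ] L2 Ω :=
  ∑ k ∈ cellIndices n R δ, (ContinuousLinearMap.toSpanSingleton ℝ (cellIndicator Ω δ k)).comp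
    ((δ ^ n)⁻¹ • innerSL ℝ (cellIndicator Ω δ k))

/-- A finite sum of operators that factor through `ℝ`. -/
lemma isCompactOperator_cellAverage (Ω : Set (E n)) (R δ : ℝ) :
    IsCompactOperator (cellAverage Ω R δ) := by
  have h : ∀ s : Finset (Fin n → ℤ), IsCompactOperator
      (∑ k ∈ s, (ContinuousLinearMap.toSpanSingleton ℝ (cellIndicator Ω δ k)).comp
        ((δ ^ n)⁻¹ • innerSL ℝ (cellIndicator Ω δ k)) : L2 Ω →L[ℝ] L2 Ω) := by
    intro s
    induction s using Finset.induction_on with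
    | empty => simpa using isCompactOperator_zero
    | insert k s hk ih =>
      rw [Finset.sum_insert hk]
      refine IsCompactOperator.add ?_ ih
      exact ((isCompactOperator_id (E := ℝ)).clm_comp
        (ContinuousLinearMap.toSpanSingleton ℝ (cellIndicator Ω δ k))).comp_clm
        ((δ ^ n)⁻¹ • innerSL ℝ (cellIndicator Ω δ k))
  exact h _

lemma cellAverage_apply (R δ : ℝ) (w : L2 Ω) : cellAverage Ω R δ w =
    ∑ k ∈ cellIndices n R δ, ((δ ^ n)⁻¹ * ∫ x in cell δ k, w x ∂(volume.restrict Ω)) •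
      cellIndicator Ω δ k := by
  simp only [cellAverage, _root_.sum_apply]
  refine Finset.sum_congr rfl fun k _ => ?_
  simp only [ContinuousLinearMap.comp_apply, _root_.smul_apply, innerSL_apply_apply,
    ContinuousLinearMap.toSpanSingleton_apply, smul_eq_mul, cellIndicator,
    L2.inner_indicatorConstLp_one]

/-- Cells may cross `∂Ω`. Because `η` vanishes outside `Ω`, its average over the full cell is the
one seen by `L²(Ω)`, and no boundary correction arises. -/
lemma setIntegral_cell_eq (hη : IsTestFunction Ω η) {w : L2 Ω}
    (hw : w =ᵐ[volume.restrict Ω] η) (δ : ℝ) (k : Fin n → ℤ) :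
    ∫ x in cell δ k, w x ∂(volume.restrict Ω) = ∫ x in cell δ k, η x := by
  rw [integral_congr_ae (ae_restrict_of_ae hw), Measure.restrict_restrict (measurableSet_cell δ k)]
  exact (setIntegral_eq_of_subset_of_forall_sdiff_eq_zero (measurableSet_cell δ k)
    Set.inter_subset_left fun x hx => hη.eq_zero fun h => hx.2 ⟨hx.1, h⟩).symm

/-- The cells are disjoint, so at `x` only the summand of its own cell survives; the bound `R`
ensures that this cell is among the finitely many summed. -/
lemma cellAverage_ae_eq {R δ : ℝ} (hδ : 0 < δ) (hΩ : MeasurableSet Ω) (hR : ∀ x ∈ Ω, ‖x‖ ≤ R)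
    (hη : IsTestFunction Ω η) {w : L2 Ω} (hw : w =ᵐ[volume.restrict Ω] η) :
    cellAverage Ω R δ w =ᵐ[volume.restrict Ω]
      fun x => (δ ^ n)⁻¹ * ∫ y in cell δ (cellIndex δ x), η y := by
  rw [cellAverage_apply]
  have h1 : ∀ᵐ x ∂(volume.restrict Ω), ∀ k ∈ cellIndices n R δ,
      (((δ ^ n)⁻¹ * ∫ x in cell δ k, w x ∂(volume.restrict Ω)) • cellIndicator Ω δ k : L2 Ω) x
        = ((δ ^ n)⁻¹ * ∫ y in cell δ k, η y) * (cell δ k).indicator (fun _ => 1) x := by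
    rw [Finset.eventually_all]
    intro k _
    filter_upwards [Lp.coeFn_smul ((δ ^ n)⁻¹ * ∫ x in cell δ k, w x ∂(volume.restrict Ω))
      (cellIndicator Ω δ k), indicatorConstLp_coeFn (p := 2) (hs := measurableSet_cell δ k)
      (hμs := volume_restrict_cell_ne_top Ω δ k) (c := (1 : ℝ))] with x h1 h2
    rw [h1, Pi.smul_apply, smul_eq_mul, setIntegral_cell_eq hη hw, cellIndicator, h2]
  filter_upwards [h1, Lp.coeFn_finsetSum (cellIndices n R δ) (fun k =>
    ((δ ^ n)⁻¹ * ∫ x in cell δ k, w x ∂(volume.restrict Ω)) • cellIndicator Ω δ k),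
    ae_restrict_mem hΩ] with x h1 h2 hx
  rw [h2, Finset.sum_apply, Finset.sum_congr rfl fun k hk => h1 k hk,
    Finset.sum_eq_single_of_mem (cellIndex δ x) (cellIndex_mem hδ (hR x hx)),
    Set.indicator_of_mem ((mem_cell_iff hδ).2 rfl), mul_one]
  intro k _ hk
  rw [Set.indicator_of_notMem fun h => hk ((mem_cell_iff hδ).1 h).symm, mul_zero]

/-- The averages over cells of side `δ` approximate a function of `H¹₀(Ω)` in `L²(Ω)`. -/
lemma norm_sub_cellAverage_le {R δ : ℝ} (hδ : 0 < δ) (hΩ : MeasurableSet Ω)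
    (hR : ∀ x ∈ Ω, ‖x‖ ≤ R) {p : L2Pair Ω} (hp : p ∈ H10 Ω) :
    ‖p.fst - cellAverage Ω R δ p.fst‖ ≤ (2 ^ n * n + 1) * δ * ‖p.snd‖ := by
  refine H10_induction
    (P := fun p => ‖p.fst - cellAverage Ω R δ p.fst‖ ≤ (2 ^ n * n + 1) * δ * ‖p.snd‖) ?_
    (fun p η hη h1 h2 => ?_) hp
  · have h1 := WithLp.continuous_fst 2 (L2 Ω) (L2Vec Ω)
    have h2 := WithLp.continuous_snd 2 (L2 Ω) (L2Vec Ω)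
    exact isClosed_le (by fun_prop) (by fun_prop)
  have h : ‖p.fst - cellAverage Ω R δ p.fst‖ₑ ^ 2
      ≤ ((2 ^ n * n + 1) * ENNReal.ofReal δ * ‖p.snd‖ₑ) ^ 2 := by
    calc ‖p.fst - cellAverage Ω R δ p.fst‖ₑ ^ 2
        = ∫⁻ x in Ω, ‖η x - (δ ^ n)⁻¹ * ∫ y in cell δ (cellIndex δ x), η y‖ₑ ^ 2 := by
          rw [enorm_sq_eq_lintegral]
          refine lintegral_congr_ae ?_
          filter_upwards [h1, cellAverage_ae_eq hδ hΩ hR hη h1,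
            Lp.coeFn_sub p.fst (cellAverage Ω R δ p.fst)] with x h1 h3 h4
          rw [h4, Pi.sub_apply, h1, h3]
      _ ≤ ∫⁻ x, (ENNReal.ofReal δ ^ n)⁻¹ * ∫⁻ h in centredCube n δ, ‖η (x + h) - η x‖ₑ ^ 2 :=
          (lintegral_mono fun x => enorm_sub_average_cell_sq_le hδ hη.1.continuous hη.2.1
            ((mem_cell_iff hδ).2 rfl)).trans (setLIntegral_le_lintegral Ω _)
      _ ≤ 2 ^ n * n * ENNReal.ofReal δ ^ 2 * ∫⁻ x, ‖gradient η x‖ₑ ^ 2 :=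
          lintegral_translates_le hδ hη.contDiff_one
      _ = 2 ^ n * n * ENNReal.ofReal δ ^ 2 * ‖p.snd‖ₑ ^ 2 := by
          rw [enorm_sq_eq_lintegral, ← hη.setLIntegral_enorm_gradient_sq]
          congr 1
          exact lintegral_congr_ae (by filter_upwards [h2] with x hx using by rw [hx])
      _ ≤ _ := by
          rw [mul_pow, mul_pow]
          gcongr
          -- The sharper constant would be the square root of `2 ^ n * n`; adding one gives a bound
          -- free of roots and positive for every `n`.
          calc (2 ^ n * n : ℝ≥0∞) ≤ 2 ^ n * n + 1 := le_self_add
            _ ≤ (2 ^ n * n + 1) ^ 2 := le_self_pow₀ le_add_self two_ne_zero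
  have h := (ENNReal.pow_le_pow_left_iff two_ne_zero).1 h
  have h := ENNReal.toReal_mono (by finiteness) h
  have hc : (2 ^ n * n + 1 : ℝ≥0∞).toReal = 2 ^ n * n + 1 := by
    rw [ENNReal.toReal_add (by finiteness) (by finiteness)]
    simp
  simpa [hc, ENNReal.toReal_ofReal hδ.le] using h

/-- The embedding of `H¹₀(Ω)` into `L²(Ω)`. -/
noncomputable def embedding (Ω : Set (E n)) : H10 Ω →L[ℝ] L2 Ω :=
  (WithLp.fstL 2 ℝ (L2 Ω) (L2Vec Ω)).comp (H10 Ω).subtypeL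

lemma embedding_apply (p : H10 Ω) : embedding Ω p = (p : L2Pair Ω).fst := rfl

/-- An operator that is approximated uniformly by compact operators is compact. -/
lemma isCompactOperator_of_approx {H K : Type*} [NormedAddCommGroup H] [NormedSpace ℝ H]
    [NormedAddCommGroup K] [NormedSpace ℝ K] [CompleteSpace K] {f : H →L[ℝ] K}
    (h : ∀ ε > 0, ∃ F : H →L[ℝ] K, IsCompactOperator F ∧ ∀ x, ‖f x - F x‖ ≤ ε * ‖x‖) :
    IsCompactOperator f := by
  have hf : f ∈ closure {F : H →L[ℝ] K | IsCompactOperator F} := by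
    refine Metric.mem_closure_iff.2 fun ε hε => ?_
    obtain ⟨F, hF, hb⟩ := h (ε / 2) (by positivity)
    refine ⟨F, hF, ?_⟩
    rw [dist_eq_norm]
    exact (ContinuousLinearMap.opNorm_le_bound (f - F) (by positivity) hb).trans_lt (by linarith)
  exact isClosed_setOfPred_isCompactOperator.closure_subset hf

/-- The Rellich theorem: the embedding of `H¹₀(Ω)` into `L²(Ω)` is compact. -/
lemma isCompactOperator_embedding (hΩ : MeasurableSet Ω) (hb : Bornology.IsBounded Ω) :
    IsCompactOperator (embedding Ω) := by
  obtain ⟨R, hR⟩ := hb.exists_norm_le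
  refine isCompactOperator_of_approx fun ε hε => ?_
  have hC : (0 : ℝ) < 2 ^ n * n + 1 := by positivity
  have hδ : 0 < ε / (2 ^ n * n + 1) := by positivity
  refine ⟨(cellAverage Ω R (ε / (2 ^ n * n + 1))).comp (embedding Ω),
    (isCompactOperator_cellAverage Ω R _).comp_clm _, fun p => ?_⟩
  refine (norm_sub_cellAverage_le hδ hΩ hR p.2).trans ?_
  rw [mul_div_cancel₀ _ hC.ne']
  exact mul_le_mul_of_nonneg_left (WithLp.norm_snd_le (L2 Ω) (p : L2Pair Ω)) hε.le

end FracControl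

/-! ### Compact symmetric operators and variational eigenvalue problems -/

namespace FracControl

section Spectral

variable {K : Type*} [NormedAddCommGroup K] [InnerProductSpace ℝ K]

/-- Distinct orthonormal vectors are `√2 > 1` apart, so the balls of radius `1/2` around them are
disjoint, and a separable space holds only countably many disjoint nonempty open sets. -/
lemma countable_of_orthonormal [TopologicalSpace.SeparableSpace K] {ι : Type*} {v : ι → K}
    (hv : Orthonormal ℝ v) : Countable ι := by
  rw [← Set.countable_univ_iff]
  refine Set.PairwiseDisjoint.countable_of_isOpen (s := fun i => Metric.ball (v i) (1 / 2))
    (fun i _ j _ hij => Metric.ball_disjoint_ball ?_) (fun i _ => Metric.isOpen_ball)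
    (fun i _ => ⟨v i, Metric.mem_ball_self (by norm_num)⟩)
  have h : ‖v i - v j‖ ^ 2 = 2 := by
    rw [@norm_sub_sq_real, hv.1 i, hv.1 j, hv.2 hij]
    norm_num
  rw [dist_eq_norm]
  nlinarith [norm_nonneg (v i - v j)]

variable [CompleteSpace K]

/-- The spectral theorem: a compact symmetric operator on an infinite-dimensional separable
Hilbert space has an orthonormal basis of eigenvectors. -/
lemma exists_hilbertBasis_eigenvectors [TopologicalSpace.SeparableSpace K]
    (hK : ¬ FiniteDimensional ℝ K) {T : K →L[ℝ] K} (hT : IsCompactOperator T)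
    (hs : (T : K →ₗ[ℝ] K).IsSymmetric) :
    ∃ (μ : ℕ → ℝ) (φ : HilbertBasis ℕ ℝ K), ∀ k, T (φ k) = μ k • φ k := by
  let V : ℝ → Submodule ℝ K := fun μ => Module.End.eigenspace (T : K →ₗ[ℝ] K) μ
  have hVmem : ∀ μ x, x ∈ V μ ↔ T x = μ • x := fun μ x => Module.End.mem_eigenspace_iff
  have hVc : ∀ μ, CompleteSpace (V μ) := fun μ => by
    have : IsClosed (V μ : Set K) := by
      have h : (V μ : Set K) = {x | T x = μ • x} := Set.ext fun x => hVmem μ x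
      rw [h]
      exact isClosed_eq T.continuous (continuous_const_smul μ)
    exact this.completeSpace_coe
  -- Eigenspaces, the kernel in particular, may be infinite-dimensional, so each gets a Hilbert
  -- basis. The union is orthonormal because distinct eigenspaces are orthogonal.
  choose w b hb using fun μ => exists_hilbertBasis ℝ (V μ)
  let v : (Σ μ, w μ) → K := fun a => (b a.1 a.2 : V a.1)
  have hv : Orthonormal ℝ v :=
    hs.orthogonalFamily_eigenspaces.orthonormal_sigma_orthonormal fun μ => (b μ).orthonormal
  have hv0 : ∀ x, (∀ a, inner ℝ x (v a) = 0) → x = 0 := by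
    intro x hx
    have h1 : ∀ μ, ∀ y ∈ V μ, inner ℝ x y = 0 := by
      intro μ y hy
      have h2 := ((b μ).hasSum_repr ⟨y, hy⟩).mapL ((innerSL ℝ x).comp (V μ).subtypeL)
      refine h2.unique ?_
      have h3 : ∀ i : w μ, inner ℝ x (b μ i : K) = 0 := fun i => hx ⟨μ, i⟩
      simp [h3]
    have h2 : x ∈ (⨆ μ, V μ)ᗮ := by
      rw [← Submodule.iInf_orthogonal, Submodule.mem_iInf]
      exact fun μ => (Submodule.mem_orthogonal' _ _).2 (h1 μ)
    -- Compactness and symmetry enter here: no nonzero vector is orthogonal to all eigenspaces.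
    have h3 := ContinuousLinearMap.orthogonalComplement_iSup_eigenspaces_eq_bot hT hs
    rw [h3] at h2
    simpa using h2
  have hTv : ∀ a, T (v a) = a.1 • v a := fun a => (hVmem a.1 _).1 (b a.1 a.2).2
  have hbot : ∀ {ι : Type} (e : ι ≃ Σ μ, w μ), (Submodule.span ℝ (Set.range (v ∘ e)))ᗮ = ⊥ := by
    intro ι e
    refine (Submodule.eq_bot_iff _).2 fun x hx => hv0 x fun a => ?_
    refine (Submodule.mem_orthogonal' _ _).1 hx _ (Submodule.subset_span ⟨e.symm a, ?_⟩)
    simp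
  have : Countable (Σ μ, w μ) := countable_of_orthonormal hv
  -- A finite orthonormal family with trivial orthogonal complement would span `K`.
  have : Infinite (Σ μ, w μ) := by
    by_contra hfin
    rw [not_infinite_iff_finite] at hfin
    have hspan : Submodule.span ℝ (Set.range v) = ⊤ := by
      have : FiniteDimensional ℝ (Submodule.span ℝ (Set.range v)) :=
        FiniteDimensional.span_of_finite ℝ (Set.finite_range v)
      refine Submodule.orthogonal_eq_bot_iff.1 ((Submodule.eq_bot_iff _).2 fun x hx =>
        hv0 x fun a => ?_)
      exact (Submodule.mem_orthogonal' _ _).1 hx _ (Submodule.subset_span ⟨a, rfl⟩)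
    refine hK (Module.finite_def.2 ?_)
    rw [← hspan]
    exact Submodule.fg_span (Set.finite_range v)
  obtain ⟨e⟩ : Nonempty (ℕ ≃ Σ μ, w μ) := nonempty_equiv_of_countable
  refine ⟨fun k => (e k).1, HilbertBasis.mkOfOrthogonalEqBot (hv.comp e e.injective) (hbot e),
    fun k => ?_⟩
  rw [HilbertBasis.coe_mkOfOrthogonalEqBot]
  exact hTv (e k)

/-- The variational eigenvalue problem of a coercive symmetric form on a compactly and densely
embedded Hilbert space. -/
lemma exists_hilbertBasis_variational [TopologicalSpace.SeparableSpace K]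
    (hK : ¬ FiniteDimensional ℝ K) {H : Type*} [NormedAddCommGroup H] [InnerProductSpace ℝ H]
    [CompleteSpace H] {ι : H →L[ℝ] K} (hι : IsCompactOperator ι)
    (hd : ∀ f : K, (∀ q, inner ℝ f (ι q) = 0) → f = 0) {B : H →L[ℝ] H →L[ℝ] ℝ}
    (hB : IsCoercive B) (hsymm : ∀ p q, B p q = B q p) :
    ∃ (lam : ℕ → ℝ) (φ : HilbertBasis ℕ ℝ K),
      ∀ k, ∃ p, ι p = φ k ∧ ∀ q, B p q = inner ℝ (lam k • φ k) (ι q) := by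
  -- The Lax–Milgram solution operator: `S f` represents `q ↦ ⟪f, ι q⟫` with respect to `B`.
  let S : K →L[ℝ] H :=
    (hB.continuousLinearEquivOfBilin.symm : H →L[ℝ] H).comp (ContinuousLinearMap.adjoint ι)
  have hS : ∀ f q, B (S f) q = inner ℝ f (ι q) := fun f q => by
    rw [← hB.continuousLinearEquivOfBilin_apply, ← ContinuousLinearMap.adjoint_inner_left]
    simp [S]
  have hcompact : IsCompactOperator (ι.comp S) := hι.comp_clm S
  have hsymmT : ((ι.comp S : K →L[ℝ] K) : K →ₗ[ℝ] K).IsSymmetric := fun f g => by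
    change inner ℝ (ι (S f)) g = inner ℝ f (ι (S g))
    rw [← hS, real_inner_comm, ← hS, hsymm]
  obtain ⟨μ, φ, hφ⟩ := exists_hilbertBasis_eigenvectors hK hcompact hsymmT
  have hφ : ∀ k, ι (S (φ k)) = μ k • φ k := hφ
  -- If `ι (S (φ k)) = 0`, then `B (S (φ k)) (S (φ k)) = 0` and coercivity gives `S (φ k) = 0`;
  -- hence `φ k` is orthogonal to the range of `ι`, which is dense.
  have hμ : ∀ k, μ k ≠ 0 := by
    intro k h0
    obtain ⟨C, hC, hcoer⟩ := hB
    have h1 : ι (S (φ k)) = 0 := by rw [hφ, h0, zero_smul]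
    have h2 := hcoer (S (φ k))
    rw [hS, h1, inner_zero_right] at h2
    have h3 : S (φ k) = 0 := by
      by_contra h
      have := norm_pos_iff.2 h
      have : 0 < C * ‖S (φ k)‖ * ‖S (φ k)‖ := by positivity
      linarith
    have h4 : φ k = 0 := hd _ fun q => by rw [← hS, h3]; simp
    exact φ.orthonormal.ne_zero k h4
  refine ⟨fun k => (μ k)⁻¹, φ, fun k => ⟨(μ k)⁻¹ • S (φ k), ?_, fun q => ?_⟩⟩
  · rw [map_smul, hφ, smul_smul, inv_mul_cancel₀ (hμ k), one_smul]
  · rw [map_smul, _root_.smul_apply, hS, real_inner_smul_left, smul_eq_mul]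

end Spectral
end FracControl

/-! ### The elliptic form and its Dirichlet eigenfunctions -/

namespace FracControl

variable {n : ℕ} {Ω : Set (E n)}

lemma memLp_top_entry (hΩ : IsOpen Ω) (hb : Bornology.IsBounded Ω) {f : E n → ℝ} {K : NNReal}
    (hf : LipschitzOnWith K f Ω) : MemLp f ⊤ (volume.restrict Ω) := by
  rcases Ω.eq_empty_or_nonempty with rfl | ⟨x₀, hx₀⟩
  · simp
  obtain ⟨C, hC⟩ := Metric.isBounded_iff.1 hb
  refine memLp_top_of_bound (hf.continuousOn.aestronglyMeasurable hΩ.measurableSet)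
    (K * C + ‖f x₀‖) ((ae_restrict_iff' hΩ.measurableSet).2 (ae_of_all _ fun x hx => ?_))
  have h1 := hf.norm_sub_le hx hx₀
  have h2 : ‖x - x₀‖ ≤ C := by
    rw [← dist_eq_norm]
    exact hC hx hx₀
  have h3 : ‖f x‖ ≤ ‖f x - f x₀‖ + ‖f x₀‖ := by
    simpa using norm_add_le (f x - f x₀) (f x₀)
  have h4 : (K : ℝ) * ‖x - x₀‖ ≤ K * C := mul_le_mul_of_nonneg_left h2 K.2
  linarith

lemma memLp_sum_smul_const {α F ι : Type*} [MeasurableSpace α] {ν : Measure α} {p : ℝ≥0∞}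
    [Fintype ι] [NormedAddCommGroup F] [NormedSpace ℝ F] {f : ι → α → ℝ}
    (hf : ∀ i, MemLp (f i) p ν) (v : ι → F) : MemLp (fun x => ∑ i, f i x • v i) p ν :=
  memLp_finsetSum _ fun i _ =>
    (ContinuousLinearMap.toSpanSingleton ℝ (v i)).comp_memLp' (hf i)

/-- Expansion in matrix units reduces the claim to the scalar entries, which are bounded as
Lipschitz functions on a bounded set. -/
lemma memLp_top_toEuclideanCLM (hΩ : IsOpen Ω) (hb : Bornology.IsBounded Ω)
    {A : E n → Matrix (Fin n) (Fin n) ℝ}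
    (hA : ∀ i j, ∃ K : NNReal, LipschitzOnWith K (fun x => A x i j) Ω) :
    MemLp (fun x => Matrix.toEuclideanCLM (𝕜 := ℝ) (A x)) ⊤ (volume.restrict Ω) := by
  have h : (fun x => Matrix.toEuclideanCLM (𝕜 := ℝ) (A x)) = fun x => ∑ q : Fin n × Fin n,
      A x q.1 q.2 • Matrix.toEuclideanCLM (𝕜 := ℝ) (Matrix.single q.1 q.2 (1 : ℝ)) := by
    ext1 x
    conv_lhs => rw [Matrix.matrix_eq_sum_single (A x)]
    simp only [map_sum, ← map_smul, Matrix.smul_single, smul_eq_mul, mul_one,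
      Fintype.sum_prod_type]
  rw [h]
  have hq : ∀ q : Fin n × Fin n, MemLp (fun x => A x q.1 q.2) ⊤ (volume.restrict Ω) := fun q => by
    obtain ⟨K, hK⟩ := hA q.1 q.2
    exact memLp_top_entry hΩ hb hK
  exact memLp_sum_smul_const hq _

/-- Multiplication by a bounded matrix field on `L²(Ω; ℝⁿ)`. -/
noncomputable def matrixMul (M : Lp (E n →L[ℝ] E n) ⊤ (volume.restrict Ω)) :
    L2Vec Ω →L[ℝ] L2Vec Ω :=
  ContinuousLinearMap.holderL (volume.restrict Ω) ⊤ 2 2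
    (ContinuousLinearMap.id ℝ (E n →L[ℝ] E n)) M

/-- Multiplication by a bounded function on `L²(Ω)`. -/
noncomputable def scalarMul (c : Lp ℝ ⊤ (volume.restrict Ω)) : L2 Ω →L[ℝ] L2 Ω :=
  ContinuousLinearMap.holderL (volume.restrict Ω) ⊤ 2 2 (ContinuousLinearMap.mul ℝ ℝ) c

lemma coeFn_matrixMul (M : Lp (E n →L[ℝ] E n) ⊤ (volume.restrict Ω)) (g : L2Vec Ω) :
    matrixMul M g =ᵐ[volume.restrict Ω] fun x => M x (g x) :=
  ContinuousLinearMap.coeFn_holder (ContinuousLinearMap.id ℝ (E n →L[ℝ] E n)) M g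

lemma coeFn_scalarMul (c : Lp ℝ ⊤ (volume.restrict Ω)) (w : L2 Ω) :
    scalarMul c w =ᵐ[volume.restrict Ω] fun x => c x * w x :=
  ContinuousLinearMap.coeFn_holder (ContinuousLinearMap.mul ℝ ℝ) c w

/-- The weak gradient, as an operator on `H¹₀(Ω)`. -/
noncomputable def weakGradient (Ω : Set (E n)) : H10 Ω →L[ℝ] L2Vec Ω :=
  (WithLp.sndL 2 ℝ (L2 Ω) (L2Vec Ω)).comp (H10 Ω).subtypeL

/-- The bilinear form `(∇w, ∇v) ↦ ∫ A ∇w · ∇v + c w v` on `H¹₀(Ω)`. -/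
noncomputable def ellipticForm (M : Lp (E n →L[ℝ] E n) ⊤ (volume.restrict Ω))
    (c : Lp ℝ ⊤ (volume.restrict Ω)) : H10 Ω →L[ℝ] H10 Ω →L[ℝ] ℝ :=
  (innerSL ℝ).bilinearComp ((matrixMul M).comp (weakGradient Ω)) (weakGradient Ω) +
    (innerSL ℝ).bilinearComp ((scalarMul c).comp (embedding Ω)) (embedding Ω)

lemma ellipticForm_apply (M : Lp (E n →L[ℝ] E n) ⊤ (volume.restrict Ω))
    (c : Lp ℝ ⊤ (volume.restrict Ω)) (p q : H10 Ω) : ellipticForm M c p q =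
      inner ℝ (matrixMul M (weakGradient Ω p)) (weakGradient Ω q) +
      inner ℝ (scalarMul c (embedding Ω p)) (embedding Ω q) := rfl

/-- The integrand of the weak formulation. -/
noncomputable def energyDensity (A : E n → Matrix (Fin n) (Fin n) ℝ) (c : E n → ℝ)
    (p q : H10 Ω) (x : E n) : ℝ :=
  ((A x).mulVec (weakGradient Ω p x).ofLp) ⬝ᵥ (weakGradient Ω q x).ofLp +
    c x * embedding Ω p x * embedding Ω q x

variable {A : E n → Matrix (Fin n) (Fin n) ℝ} {c : E n → ℝ}

lemma inner_toEuclideanCLM (M : Matrix (Fin n) (Fin n) ℝ) (g h : E n) :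
    inner ℝ (Matrix.toEuclideanCLM (𝕜 := ℝ) M g) h = (M.mulVec g.ofLp) ⬝ᵥ h.ofLp := by
  rw [EuclideanSpace.inner_eq_star_dotProduct, Matrix.ofLp_toEuclideanCLM, star_trivial,
    dotProduct_comm]

lemma energyDensity_ae_eq
    (hM : MemLp (fun x => Matrix.toEuclideanCLM (𝕜 := ℝ) (A x)) ⊤ (volume.restrict Ω))
    (hc : MemLp c ⊤ (volume.restrict Ω)) (p q : H10 Ω) :
    (fun x => inner ℝ (matrixMul (hM.toLp _) (weakGradient Ω p) x) (weakGradient Ω q x) +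
      inner ℝ (scalarMul (hc.toLp _) (embedding Ω p) x) (embedding Ω q x))
      =ᵐ[volume.restrict Ω] energyDensity A c p q := by
  filter_upwards [hM.coeFn_toLp, hc.coeFn_toLp, coeFn_matrixMul (hM.toLp _) (weakGradient Ω p),
    coeFn_scalarMul (hc.toLp _) (embedding Ω p)] with x h1 h2 h3 h4
  rw [h3, h4, h1, h2, inner_toEuclideanCLM, energyDensity]
  congr 1
  exact mul_comm _ _

lemma integrable_energyDensity
    (hM : MemLp (fun x => Matrix.toEuclideanCLM (𝕜 := ℝ) (A x)) ⊤ (volume.restrict Ω))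
    (hc : MemLp c ⊤ (volume.restrict Ω)) (p q : H10 Ω) :
    Integrable (energyDensity A c p q) (volume.restrict Ω) :=
  ((L2.integrable_inner _ _).add (L2.integrable_inner _ _)).congr (energyDensity_ae_eq hM hc p q)

lemma ellipticForm_eq_integral
    (hM : MemLp (fun x => Matrix.toEuclideanCLM (𝕜 := ℝ) (A x)) ⊤ (volume.restrict Ω))
    (hc : MemLp c ⊤ (volume.restrict Ω)) (p q : H10 Ω) :
    ellipticForm (hM.toLp _) (hc.toLp _) p q = ∫ x in Ω, energyDensity A c p q x := by
  rw [ellipticForm_apply, L2.inner_def, L2.inner_def,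
    ← integral_add (L2.integrable_inner _ _) (L2.integrable_inner _ _)]
  exact integral_congr_ae (energyDensity_ae_eq hM hc p q)

lemma energyDensity_symm (hA : ∀ x ∈ Ω, (A x).IsSymm) (p q : H10 Ω) {x : E n} (hx : x ∈ Ω) :
    energyDensity A c p q x = energyDensity A c q p x := by
  have h : ∀ g h : Fin n → ℝ, ((A x).mulVec g) ⬝ᵥ h = ((A x).mulVec h) ⬝ᵥ g := fun g h => by
    rw [dotProduct_comm, Matrix.dotProduct_mulVec, ← Matrix.mulVec_transpose, (hA x hx).eq]
  rw [energyDensity, energyDensity, h]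
  ring

/-- Ellipticity pointwise, with the nonnegative term `c w²` dropped. This yields both the coercivity
of the form and the lower bound for the eigenvalues. -/
lemma mul_norm_weakGradient_sq_le {θ : ℝ} (hΩ : IsOpen Ω)
    (hM : MemLp (fun x => Matrix.toEuclideanCLM (𝕜 := ℝ) (A x)) ⊤ (volume.restrict Ω))
    (hA : ∀ x ∈ Ω, ∀ ξ : Fin n → ℝ, θ * (ξ ⬝ᵥ ξ) ≤ ξ ⬝ᵥ ((A x).mulVec ξ))
    (hc : MemLp c ⊤ (volume.restrict Ω)) (hc0 : ∀ᵐ x ∂(volume.restrict Ω), 0 ≤ c x) (p : H10 Ω) :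
    θ * ‖weakGradient Ω p‖ ^ 2 ≤ ∫ x in Ω, energyDensity A c p p x := by
  rw [← real_inner_self_eq_norm_sq, L2.inner_def, ← integral_const_mul]
  refine integral_mono_ae ((L2.integrable_inner _ _).const_mul θ)
    (integrable_energyDensity hM hc p p) ?_
  filter_upwards [hc0, ae_restrict_mem hΩ.measurableSet] with x h1 hx
  have h2 := hA x hx (weakGradient Ω p x).ofLp
  rw [dotProduct_comm _ ((A x).mulVec _)] at h2
  have h3 : inner ℝ (weakGradient Ω p x) (weakGradient Ω p x)
      = (weakGradient Ω p x).ofLp ⬝ᵥ (weakGradient Ω p x).ofLp := by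
    rw [EuclideanSpace.inner_eq_star_dotProduct, star_trivial]
  have h4 : 0 ≤ c x * embedding Ω p x * embedding Ω p x := by
    rw [mul_assoc]
    exact mul_nonneg h1 (mul_self_nonneg _)
  simp only [energyDensity, h3]
  linarith

lemma isWeakSolution_iff {w f : L2 Ω} : IsWeakSolution A c w f ↔
    ∃ p : H10 Ω, embedding Ω p = w ∧ ∀ q : H10 Ω,
      ∫ x in Ω, energyDensity A c p q x = inner ℝ f (embedding Ω q) := by
  have hf : ∀ v : L2 Ω, inner ℝ f v = ∫ x in Ω, f x * v x := fun v => by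
    rw [L2.inner_def]
    exact integral_congr_ae (ae_of_all _ fun x => mul_comm _ _)
  constructor
  · rintro ⟨g, hg, h⟩
    refine ⟨⟨WithLp.toLp 2 (w, g), memH10_iff.1 hg⟩, rfl, fun q => ?_⟩
    rw [hf]
    exact h _ _ (memH10_fst_snd q)
  · rintro ⟨p, rfl, h⟩
    refine ⟨weakGradient Ω p, memH10_fst_snd p, fun v g hv => ?_⟩
    have := h ⟨WithLp.toLp 2 (v, g), memH10_iff.1 hv⟩
    rw [hf] at this
    exact this

/-- Functions orthogonal to `H¹₀(Ω)` vanish. -/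
lemma eq_zero_of_inner_embedding_eq_zero (hΩ : IsOpen Ω) {f : L2 Ω}
    (h : ∀ q, inner ℝ f (embedding Ω q) = 0) : f = 0 := by
  have hloc : LocallyIntegrableOn f Ω (volume.restrict Ω) :=
    ((Lp.memLp f).locallyIntegrable (by norm_num)).locallyIntegrableOn Ω
  -- Test functions lie in `H¹₀(Ω)`, so the fundamental lemma of the calculus of variations applies.
  have h0 := hΩ.ae_eq_zero_of_integral_contDiff_smul_eq_zero hloc fun η h1 h2 h3 => by
    have hη : IsTestFunction Ω η := ⟨h1, h2, h3⟩
    have h4 := h ⟨_, hη.mem_H10⟩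
    rw [embedding_apply, WithLp.toLp_fst, L2.inner_def] at h4
    rw [← h4]
    refine integral_congr_ae ?_
    filter_upwards [hη.memLp.coeFn_toLp] with x hx
    rw [hx]
    rfl
  refine Lp.eq_zero_iff_ae_eq_zero.2 ?_
  filter_upwards [h0, ae_restrict_mem hΩ.measurableSet] with x h1 h2 using h1 h2

lemma separableSpace_L2 (Ω : Set (E n)) : TopologicalSpace.SeparableSpace (L2 Ω) := by
  have : Fact ((2 : ℝ≥0∞) ≠ ⊤) := ⟨ENNReal.ofNat_ne_top⟩
  infer_instance

/-- Needed to index the eigenbasis by all of `ℕ`. -/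
lemma not_finiteDimensional_L2 (hn : 1 ≤ n) (hΩ : IsOpen Ω) (hne : Ω.Nonempty)
    (hb : Bornology.IsBounded Ω) : ¬ FiniteDimensional ℝ (L2 Ω) := by
  intro hfin
  have : Nonempty (Fin n) := ⟨⟨0, hn⟩⟩
  have : Infinite Ω := by
    obtain ⟨x, hx⟩ := hne
    exact (infinite_of_mem_nhds x (hΩ.mem_nhds hx)).to_subtype
  -- Infinitely many disjoint nonempty open subsets of `Ω` have positive measure, and their
  -- indicators are nonzero and mutually orthogonal.
  obtain ⟨U, hUi, hUo, hUd⟩ := exists_seq_infinite_isOpen_pairwise_disjoint Ω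
  have hVo : ∀ k, IsOpen ((↑) '' U k : Set (E n)) := fun k =>
    hΩ.isOpenMap_subtype_val _ (hUo k)
  have hVm := fun k => (hVo k).measurableSet
  have hfinm : ∀ k, volume.restrict Ω ((↑) '' U k : Set (E n)) ≠ ⊤ := fun k =>
    ne_top_of_le_ne_top (hb.measure_lt_top (μ := volume)).ne
      ((measure_mono (Set.subset_univ _)).trans_eq (by simp))
  have hpos : ∀ k, 0 < volume.restrict Ω ((↑) '' U k : Set (E n)) := fun k => by
    rw [Measure.restrict_apply (hVm k), Set.inter_eq_left.2 (Subtype.coe_image_subset _ _)]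
    exact (hVo k).measure_pos volume ((hUi k).nonempty.image _)
  have hli : LinearIndependent ℝ fun k => indicatorConstLp 2 (hVm k) (hfinm k) (1 : ℝ) := by
    refine linearIndependent_of_ne_zero_of_inner_eq_zero (𝕜 := ℝ) (fun k h0 => ?_)
      fun i j hij => ?_
    · have h1 := congrArg norm h0
      rw [norm_indicatorConstLp two_ne_zero ENNReal.ofNat_ne_top, norm_zero, norm_one, one_mul,
        Real.rpow_eq_zero measureReal_nonneg (by norm_num)] at h1
      exact (ENNReal.toReal_pos (hpos k).ne' (hfinm k)).ne' h1
    · beta_reduce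
      rw [L2.real_inner_indicatorConstLp_one_indicatorConstLp_one (hVm i) (hVm j) (hfinm i)
        (hfinm j), ((Set.disjoint_image_iff Subtype.val_injective).2 (hUd hij)).inter_eq,
        measureReal_empty]
  exact not_finite_iff_infinite.2 inferInstance hli.finite

/-- `L²(Ω)` has an orthonormal basis of Dirichlet eigenfunctions. -/
theorem exists_isEigenbasis (hn : 1 ≤ n) (hΩ : IsOpen Ω) (hb : Bornology.IsBounded Ω)
    (hne : Ω.Nonempty) (hA_lip : ∀ i j, ∃ K : NNReal, LipschitzOnWith K (fun x => A x i j) Ω)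
    (hA_symm : ∀ x ∈ Ω, (A x).IsSymm) {θ : ℝ} (hθ : 0 < θ)
    (hA : ∀ x ∈ Ω, ∀ ξ : Fin n → ℝ, θ * (ξ ⬝ᵥ ξ) ≤ ξ ⬝ᵥ ((A x).mulVec ξ))
    (hc : MemLp c ⊤ (volume.restrict Ω)) (hc0 : ∀ᵐ x ∂(volume.restrict Ω), 0 ≤ c x) :
    ∃ (lam : ℕ → ℝ) (φ : HilbertBasis ℕ ℝ (L2 Ω)), IsEigenbasis A c lam φ := by
  have hM := memLp_top_toEuclideanCLM hΩ hb hA_lip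
  obtain ⟨R, hR⟩ := exists_poincare_H10 hn hΩ hb
  have hsep := separableSpace_L2 Ω
  have hcoer : IsCoercive (ellipticForm (hM.toLp _) (hc.toLp _)) := by
    -- Poincaré gives `‖w‖² + ‖∇w‖² ≤ (R² + 1) ‖∇w‖²`.
    refine ⟨θ / (R ^ 2 + 1), by positivity, fun p => ?_⟩
    rw [ellipticForm_eq_integral]
    refine le_trans ?_ (mul_norm_weakGradient_sq_le hΩ hM hA hc hc0 p)
    have h1 : ‖p‖ ^ 2 = ‖(p : L2Pair Ω).fst‖ ^ 2 + ‖weakGradient Ω p‖ ^ 2 :=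
      WithLp.prod_norm_sq_eq_of_L2 (p : L2Pair Ω)
    have h2 : ‖(p : L2Pair Ω).fst‖ ^ 2 ≤ (R * ‖weakGradient Ω p‖) ^ 2 :=
      pow_le_pow_left₀ (norm_nonneg _) (hR _ p.2) 2
    rw [mul_assoc, ← pow_two, div_mul_eq_mul_div, div_le_iff₀ (by positivity), mul_assoc]
    exact mul_le_mul_of_nonneg_left (by linarith) hθ.le
  obtain ⟨lam, φ, h⟩ := exists_hilbertBasis_variational (not_finiteDimensional_L2 hn hΩ hne hb)
    (isCompactOperator_embedding hΩ.measurableSet hb)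
    (fun f => eq_zero_of_inner_embedding_eq_zero hΩ) hcoer fun p q => by
      rw [ellipticForm_eq_integral, ellipticForm_eq_integral]
      exact setIntegral_congr_fun hΩ.measurableSet fun x hx => energyDensity_symm hA_symm p q hx
  refine ⟨lam, φ, fun k => isWeakSolution_iff.2 ?_⟩
  obtain ⟨p, hp, hq⟩ := h k
  exact ⟨p, hp, fun q => by rw [← hq, ellipticForm_eq_integral]⟩

/-- The Dirichlet eigenvalues are bounded below by a positive constant. -/
theorem exists_eigenvalue_lower_bound (hn : 1 ≤ n) (hΩ : IsOpen Ω) (hb : Bornology.IsBounded Ω)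
    (hA_lip : ∀ i j, ∃ K : NNReal, LipschitzOnWith K (fun x => A x i j) Ω) {θ : ℝ} (hθ : 0 < θ)
    (hA : ∀ x ∈ Ω, ∀ ξ : Fin n → ℝ, θ * (ξ ⬝ᵥ ξ) ≤ ξ ⬝ᵥ ((A x).mulVec ξ))
    (hc : MemLp c ⊤ (volume.restrict Ω)) (hc0 : ∀ᵐ x ∂(volume.restrict Ω), 0 ≤ c x) :
    ∃ m > 0, ∀ (lam : ℕ → ℝ) (φ : HilbertBasis ℕ ℝ (L2 Ω)), IsEigenbasis A c lam φ →
      ∀ k, m ≤ lam k := by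
  have hM := memLp_top_toEuclideanCLM hΩ hb hA_lip
  obtain ⟨R, hR⟩ := exists_poincare_H10 hn hΩ hb
  refine ⟨θ / (R ^ 2 + 1), by positivity, fun lam φ h k => ?_⟩
  obtain ⟨p, hp, hq⟩ := isWeakSolution_iff.1 (h k)
  -- The eigenvalue equation tested with `φ k` itself gives `θ ‖∇φₖ‖² ≤ λₖ`, while Poincaré gives `1
  -- ≤ R² ‖∇φₖ‖²`.
  have h1 := mul_norm_weakGradient_sq_le hΩ hM hA hc hc0 p
  have h2 : ‖φ k‖ ^ 2 ≤ (R * ‖weakGradient Ω p‖) ^ 2 :=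
    pow_le_pow_left₀ (norm_nonneg _) (hp ▸ hR _ p.2) 2
  rw [hq, hp, real_inner_smul_left, real_inner_self_eq_norm_sq, φ.orthonormal.1 k] at h1
  rw [φ.orthonormal.1 k] at h2
  rw [div_le_iff₀ (by positivity)]
  have h3 : 0 ≤ ‖weakGradient Ω p‖ ^ 2 := sq_nonneg _
  have h4 : 0 ≤ lam k := by
    have : 0 ≤ θ * ‖weakGradient Ω p‖ ^ 2 := by positivity
    linarith
  nlinarith [mul_le_mul_of_nonneg_left h1 (sq_nonneg (R : ℝ)), mul_le_mul_of_nonneg_left h2 hθ.le]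

end FracControl

/-! ### Linear-quadratic tracking problems in Hilbert space -/

namespace FracControl

section Tracking

variable {K : Type*} [NormedAddCommGroup K] [InnerProductSpace ℝ K]

/-- The reduced cost functional of a linear-quadratic tracking problem. -/
noncomputable def trackingCost (S : K →L[ℝ] K) (μ : ℝ) (ud z : K) : ℝ :=
  1 / 2 * ‖S z - ud‖ ^ 2 + μ / 2 * ‖z‖ ^ 2

/-- The cost is quadratic, so its second-order expansion is exact. Self-adjointness moves `S` off
`h` and exhibits the gradient `μ • z + S (S z - ud)`. -/
lemma trackingCost_add_smul {S : K →L[ℝ] K} (hS : ∀ x y, inner ℝ (S x) y = inner ℝ x (S y))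
    (μ : ℝ) (ud z h : K) (t : ℝ) : trackingCost S μ ud (z + t • h) = trackingCost S μ ud z +
      t * inner ℝ (μ • z + S (S z - ud)) h + t ^ 2 * (1 / 2 * ‖S h‖ ^ 2 + μ / 2 * ‖h‖ ^ 2) := by
  have h1 : S (z + t • h) - ud = (S z - ud) + t • S h := by
    rw [map_add, map_smul]
    abel
  rw [trackingCost, trackingCost, h1, norm_add_sq_real, norm_add_sq_real, inner_add_left, hS,
    norm_smul, norm_smul, mul_pow, mul_pow, inner_smul_right, inner_smul_right,
    real_inner_smul_left, Real.norm_eq_abs, sq_abs]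
  ring

/-- Necessity: compare with `z + t • (z' - z)`, divide by `t` and let `t → 0⁺`. Sufficiency: at `t =
1` the quadratic remainder is nonnegative. -/
lemma isMinOn_trackingCost_iff {S : K →L[ℝ] K} (hS : ∀ x y, inner ℝ (S x) y = inner ℝ x (S y))
    {μ : ℝ} (hμ : 0 < μ) (ud : K) {Z : Set K} (hZ : Convex ℝ Z) {z : K} (hz : z ∈ Z) :
    (∀ z' ∈ Z, trackingCost S μ ud z ≤ trackingCost S μ ud z') ↔
      ∀ z' ∈ Z, 0 ≤ inner ℝ (μ • z + S (S z - ud)) (z' - z) := by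
  constructor
  · intro h z' hz'
    obtain ⟨Q, hQ⟩ : ∃ Q, Q = 1 / 2 * ‖S (z' - z)‖ ^ 2 + μ / 2 * ‖z' - z‖ ^ 2 := ⟨_, rfl⟩
    have hlim : Tendsto (fun t : ℝ => inner ℝ (μ • z + S (S z - ud)) (z' - z) + t * Q) (𝓝[>] 0)
        (𝓝 (inner ℝ (μ • z + S (S z - ud)) (z' - z))) := by
      have : Continuous fun t : ℝ => inner ℝ (μ • z + S (S z - ud)) (z' - z) + t * Q := by fun_prop
      refine Tendsto.mono_left ?_ nhdsWithin_le_nhds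
      simpa using this.tendsto 0
    refine ge_of_tendsto hlim ?_
    filter_upwards [Ioo_mem_nhdsGT (zero_lt_one' ℝ)] with t ht
    have h1 := h (z + t • (z' - z)) (hZ.add_smul_sub_mem hz hz' ⟨ht.1.le, ht.2.le⟩)
    rw [trackingCost_add_smul hS, ← hQ] at h1
    refine nonneg_of_mul_nonneg_right (a := t) ?_ ht.1
    rw [mul_add, ← mul_assoc, ← pow_two]
    linarith
  · intro h z' hz'
    have h1 := trackingCost_add_smul hS μ ud z (z' - z) 1
    rw [one_smul, add_sub_cancel] at h1
    have h2 := h z' hz'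
    have h3 : 0 ≤ 1 / 2 * ‖S (z' - z)‖ ^ 2 + μ / 2 * ‖z' - z‖ ^ 2 := by positivity
    linarith

/-- Adding the two inequalities leaves `-(μ ‖y - z‖² + ‖S (y - z)‖²) ≥ 0`. -/
lemma eq_of_variationalInequality {S : K →L[ℝ] K}
    (hS : ∀ x y, inner ℝ (S x) y = inner ℝ x (S y)) {μ : ℝ} (hμ : 0 < μ) (ud : K) {y z : K}
    (hy : 0 ≤ inner ℝ (μ • y + S (S y - ud)) (z - y))
    (hz : 0 ≤ inner ℝ (μ • z + S (S z - ud)) (y - z)) : y = z := by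
  have h1 : inner ℝ (μ • y + S (S y - ud)) (z - y) + inner ℝ (μ • z + S (S z - ud)) (y - z)
      = -(μ * ‖y - z‖ ^ 2 + ‖S (y - z)‖ ^ 2) := by
    rw [← neg_sub y z, inner_neg_right, ← real_inner_self_eq_norm_sq (y - z),
      ← real_inner_self_eq_norm_sq (S (y - z)), ← hS]
    simp only [map_sub, inner_sub_left, inner_add_left, real_inner_smul_left]
    ring
  have h2 : μ * ‖y - z‖ ^ 2 ≤ 0 := by nlinarith [sq_nonneg ‖S (y - z)‖]
  have h3 : ‖y - z‖ ^ 2 ≤ 0 := nonpos_of_mul_nonpos_right h2 hμ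
  exact sub_eq_zero.1 (norm_eq_zero.1 (pow_eq_zero_iff two_ne_zero |>.1
    (le_antisymm h3 (sq_nonneg _))))

/-- A linear-quadratic tracking problem with closed convex constraints has a solution. -/
lemma exists_isMinOn_trackingCost [CompleteSpace K] (S : K →L[ℝ] K) {μ : ℝ} (hμ : 0 < μ) (ud : K)
    {Z : Set K} (hne : Z.Nonempty) (hcl : IsClosed Z) (hZ : Convex ℝ Z) :
    ∃ z ∈ Z, ∀ z' ∈ Z, trackingCost S μ ud z ≤ trackingCost S μ ud z' := by
  -- With `L z = (S z, √μ z)` the cost is half the squared distance from `(ud, 0)` to `L z`. As `√μ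
  -- > 0` bounds `L` below, `L '' Z` is complete, and the projection theorem applies without weak
  -- compactness.
  let L : K →L[ℝ] WithLp 2 (K × K) :=
    ((WithLp.prodContinuousLinearEquiv 2 ℝ K K).symm : K × K →L[ℝ] WithLp 2 (K × K)).comp
      (S.prod (√μ • ContinuousLinearMap.id ℝ K))
  have hL : ∀ z, L z = WithLp.toLp 2 (S z, √μ • z) := fun z => rfl
  have hLnorm : ∀ z, ‖z‖ ≤ (√μ)⁻¹ * ‖L z‖ := fun z => by
    have hs : 0 < √μ := Real.sqrt_pos.2 hμ
    have h1 := WithLp.norm_snd_le K (L z)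
    rw [hL, WithLp.toLp_snd, norm_smul, Real.norm_of_nonneg hs.le] at h1
    rw [hL, inv_mul_eq_div, le_div_iff₀ hs, mul_comm]
    exact h1
  have hanti : AntilipschitzWith (Real.toNNReal (√μ)⁻¹) L :=
    AddMonoidHomClass.antilipschitz_of_bound L fun z => by
      rw [Real.coe_toNNReal _ (by positivity)]
      exact hLnorm z
  have hcomplete : IsComplete (L '' Z) :=
    (hanti.isUniformInducing L.uniformContinuous).isComplete_iff.2 hcl.isComplete
  have hcost : ∀ z, ‖WithLp.toLp 2 (ud, (0 : K)) - L z‖ ^ 2 = 2 * trackingCost S μ ud z := by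
    intro z
    rw [WithLp.prod_norm_sq_eq_of_L2, hL, WithLp.sub_fst, WithLp.sub_snd, WithLp.toLp_fst,
      WithLp.toLp_fst, WithLp.toLp_snd, WithLp.toLp_snd, zero_sub, norm_neg, norm_smul, mul_pow,
      Real.norm_of_nonneg (Real.sqrt_nonneg μ), Real.sq_sqrt hμ.le, norm_sub_rev, trackingCost]
    ring
  obtain ⟨_, ⟨z, hz, rfl⟩, hmin⟩ := exists_norm_eq_iInf_of_complete_convex (hne.image L) hcomplete
    (hZ.linear_image (L : K →ₗ[ℝ] WithLp 2 (K × K))) (WithLp.toLp 2 (ud, (0 : K)))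
  refine ⟨z, hz, fun z' hz' => ?_⟩
  have h1 : ‖WithLp.toLp 2 (ud, (0 : K)) - L z‖ ≤ ‖WithLp.toLp 2 (ud, (0 : K)) - L z'‖ := by
    rw [hmin]
    exact ciInf_le ⟨0, by rintro _ ⟨w, rfl⟩; exact norm_nonneg _⟩
      (⟨L z', z', hz', rfl⟩ : L '' Z)
  have h2 := pow_le_pow_left₀ (norm_nonneg _) h1 2
  rw [hcost, hcost] at h2
  linarith

end Tracking

/-! ### The fractional power in coordinates and the control-to-state operator -/

section Fractional

variable {n : ℕ} {Ω : Set (E n)} {lam : ℕ → ℝ} {φ : HilbertBasis ℕ ℝ (L2 Ω)} {s : ℝ}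

lemma hasSum_coeff_mul (φ : HilbertBasis ℕ ℝ (L2 Ω)) (v w : L2 Ω) :
    HasSum (fun k => coeff φ v k * coeff φ w k) (inner ℝ v w) := by
  have h : (fun k => coeff φ v k * coeff φ w k) =
      fun k => inner ℝ v (φ k) * inner ℝ (φ k) w := funext fun k => by
    rw [coeff, coeff, real_inner_comm v (φ k)]
  rw [h]
  exact φ.hasSum_inner_mul_inner v w

lemma coeff_ext {v w : L2 Ω} (h : ∀ k, coeff φ v k = coeff φ w k) : v = w := by
  refine φ.repr.injective (lp.ext (funext fun k => ?_))
  rw [φ.repr_apply_apply, φ.repr_apply_apply]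
  exact h k

lemma exists_coeff_eq (φ : HilbertBasis ℕ ℝ (L2 Ω)) {a : ℕ → ℝ} (ha : Summable fun k => a k ^ 2) :
    ∃ w : L2 Ω, ∀ k, coeff φ w k = a k := by
  have hmem : Memℓp a 2 := memℓp_gen (by simpa using ha)
  refine ⟨φ.repr.symm ⟨a, hmem⟩, fun k => ?_⟩
  rw [coeff, ← φ.repr_apply_apply, LinearIsometryEquiv.apply_symm_apply]

lemma coeff_basis (φ : HilbertBasis ℕ ℝ (L2 Ω)) (k j : ℕ) :
    coeff φ (φ k) j = if j = k then 1 else 0 :=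
  orthonormal_iff_ite.1 φ.orthonormal j k

lemma basis_mem_Hs (k : ℕ) : φ k ∈ Hs lam φ s := by
  refine summable_of_ne_finset_zero (s := {k}) fun j hj => ?_
  rw [coeff_basis, if_neg (by simpa using hj)]
  simp

lemma fracPower_basis (u : Hs lam φ s) (k : ℕ) :
    fracPower lam φ s u ⟨φ k, basis_mem_Hs k⟩ = lam k ^ s * coeff φ u k := by
  change ∑' j, lam j ^ s * coeff φ u j * coeff φ (φ k) j = _
  rw [tsum_eq_single k fun j hj => by rw [coeff_basis, if_neg hj, mul_zero], coeff_basis, if_pos rfl,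
    mul_one]

/-- The equation is diagonal: testing with `φ k` isolates the `k`-th coefficient, and Parseval
recovers all test functions from these. -/
lemma isState_toDual_iff {z : L2 Ω} {u : Hs lam φ s} :
    IsState lam φ s (toDual lam φ s z) u ↔ ∀ k, lam k ^ s * coeff φ u k = coeff φ z k := by
  constructor
  · intro h k
    rw [← fracPower_basis, h]
    change inner ℝ z (φ k) = inner ℝ (φ k) z
    exact real_inner_comm _ _
  · intro h
    refine LinearMap.ext fun v => ?_
    change ∑' k, lam k ^ s * coeff φ u k * coeff φ v k = inner ℝ z (v : L2 Ω)
    simp only [h]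
    exact (hasSum_coeff_mul φ z v).tsum_eq

variable {d : ℝ}

lemma mul_norm_sq_le_hsNorm_sq (hd : 0 < d) (hlam : ∀ k, d ≤ lam k ^ s) (v : Hs lam φ s) :
    d * ‖(v : L2 Ω)‖ ^ 2 ≤ hsNorm lam φ s v ^ 2 := by
  have h0 : ∀ k, 0 ≤ lam k ^ s * coeff φ v k ^ 2 := fun k =>
    mul_nonneg (hd.le.trans (hlam k)) (sq_nonneg _)
  rw [hsNorm, Real.sq_sqrt (tsum_nonneg h0), ← real_inner_self_eq_norm_sq]
  refine hasSum_le (fun k => ?_) ((hasSum_coeff_mul φ v v).mul_left d) v.2.hasSum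
  rw [← pow_two]
  exact mul_le_mul_of_nonneg_right (hlam k) (sq_nonneg _)

lemma toDual_mem_HsDual (hd : 0 < d) (hlam : ∀ k, d ≤ lam k ^ s) (z : L2 Ω) :
    toDual lam φ s z ∈ HsDual lam φ s := by
  refine ⟨‖z‖ * (√d)⁻¹, fun v => ?_⟩
  have h1 : √d * ‖(v : L2 Ω)‖ ≤ hsNorm lam φ s v := by
    refine le_of_sq_le_sq ?_ (Real.sqrt_nonneg _)
    rw [mul_pow, Real.sq_sqrt hd.le]
    exact mul_norm_sq_le_hsNorm_sq hd hlam v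
  have h2 : ‖(v : L2 Ω)‖ ≤ (√d)⁻¹ * hsNorm lam φ s v := by
    rw [inv_mul_eq_div, le_div_iff₀ (Real.sqrt_pos.2 hd), mul_comm]
    exact h1
  rw [mul_assoc]
  exact (abs_real_inner_le_norm z (v : L2 Ω)).trans
    (mul_le_mul_of_nonneg_left h2 (norm_nonneg z))

/-- The finite sum `∑_{k ∈ F} aₖ φₖ`, in `ℍˢ(Ω)`. -/
noncomputable def basisSum (lam : ℕ → ℝ) (φ : HilbertBasis ℕ ℝ (L2 Ω)) (s : ℝ) (a : ℕ → ℝ)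
    (F : Finset ℕ) : Hs lam φ s :=
  ∑ k ∈ F, a k • (⟨φ k, basis_mem_Hs k⟩ : Hs lam φ s)

lemma coeff_basisSum (a : ℕ → ℝ) (F : Finset ℕ) (j : ℕ) :
    coeff φ (basisSum lam φ s a F) j = if j ∈ F then a j else 0 := by
  have h : ∀ k, inner ℝ (φ j) (φ k) = if j = k then (1 : ℝ) else 0 := fun k => coeff_basis φ k j
  simp [coeff, basisSum, inner_sum, inner_smul_right, h]

lemma apply_basisSum (l : Module.Dual ℝ (Hs lam φ s)) (a : ℕ → ℝ) (F : Finset ℕ) :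
    l (basisSum lam φ s a F) = ∑ k ∈ F, a k * l ⟨φ k, basis_mem_Hs k⟩ := by
  rw [basisSum, map_sum]
  exact Finset.sum_congr rfl fun k _ => by rw [map_smul, smul_eq_mul]

lemma hsNorm_basisSum (a : ℕ → ℝ) (F : Finset ℕ) :
    hsNorm lam φ s (basisSum lam φ s a F) = √(∑ k ∈ F, lam k ^ s * a k ^ 2) := by
  rw [hsNorm, tsum_eq_sum (s := F) fun k hk => by rw [coeff_basisSum, if_neg hk]; simp]
  congr 1
  exact Finset.sum_congr rfl fun k hk => by rw [coeff_basisSum, if_pos hk]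

/-- The squared error is the tail of the convergent series defining the norm. Density of finite sums
lets a bounded functional be determined by its values on the basis. -/
lemma tendsto_hsNorm_sub_basisSum (v : Hs lam φ s) :
    Tendsto (fun F => hsNorm lam φ s (v - basisSum lam φ s (coeff φ v) F)) atTop (𝓝 0) := by
  have h1 : ∀ F, hsNorm lam φ s (v - basisSum lam φ s (coeff φ v) F)
      = √((∑' k, lam k ^ s * coeff φ v k ^ 2) - ∑ k ∈ F, lam k ^ s * coeff φ v k ^ 2) := by
    intro F
    have h2 : HasSum (fun k => if k ∈ F then lam k ^ s * coeff φ v k ^ 2 else 0)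
        (∑ k ∈ F, lam k ^ s * coeff φ v k ^ 2) := by
      have h3 := hasSum_sum_of_ne_finset_zero (L := .unconditional ℕ) (s := F)
        (f := fun k => if k ∈ F then lam k ^ s * coeff φ v k ^ 2 else 0)
        (fun k hk => if_neg hk)
      rwa [Finset.sum_congr rfl fun k hk => if_pos hk] at h3
    rw [hsNorm, ← (v.2.hasSum.sub h2).tsum_eq]
    congr 1
    refine tsum_congr fun k => ?_
    have h3 : coeff φ ((v - basisSum lam φ s (coeff φ v) F : Hs lam φ s) : L2 Ω) k
        = coeff φ v k - if k ∈ F then coeff φ v k else 0 := by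
      rw [← coeff_basisSum (lam := lam) (φ := φ) (s := s)]
      exact inner_sub_right _ _ _
    rw [h3]
    split_ifs <;> simp
  simp only [h1]
  have h4 := (tendsto_const_nhds (x := ∑' k, lam k ^ s * coeff φ v k ^ 2)).sub v.2.hasSum
  rw [sub_self] at h4
  simpa [Function.comp_def] using (Real.continuous_sqrt.tendsto 0).comp h4

/-- The state equation is uniquely solvable for every right-hand side in the dual of `ℍˢ(Ω)`. -/
theorem existsUnique_isState (hd : 0 < d) (hlam : ∀ k, d ≤ lam k ^ s)
    {l : Module.Dual ℝ (Hs lam φ s)} (hl : l ∈ HsDual lam φ s) :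
    ∃! u : Hs lam φ s, IsState lam φ s l u := by
  have hpos : ∀ k, 0 < lam k ^ s := fun k => hd.trans_le (hlam k)
  obtain ⟨C, hC⟩ := hl
  set b : ℕ → ℝ := fun k => l ⟨φ k, basis_mem_Hs k⟩
  set a : ℕ → ℝ := fun k => (lam k ^ s)⁻¹ * b k
  have hab : ∀ k, lam k ^ s * a k = b k := fun k => mul_inv_cancel_left₀ (hpos k).ne' _
  -- On the partial sum of `∑ aₖ φₖ` over `F`, `l` equals `X = ∑_{k ∈ F} λₖˢ aₖ²`, and boundedness
  -- reads `X ≤ C √X`. Hence `X ≤ C²` uniformly in `F`, which is the Riesz representation done by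
  -- hand.
  have hsum : Summable fun k => lam k ^ s * a k ^ 2 := by
    refine summable_of_sum_le (c := C ^ 2) (fun k => mul_nonneg (hpos k).le (sq_nonneg _))
      fun F => ?_
    have h0 : 0 ≤ ∑ k ∈ F, lam k ^ s * a k ^ 2 :=
      Finset.sum_nonneg fun k _ => mul_nonneg (hpos k).le (sq_nonneg _)
    have h1 := (le_abs_self _).trans (hC (basisSum lam φ s a F))
    rw [apply_basisSum, hsNorm_basisSum,
      Finset.sum_congr rfl fun k _ => show a k * b k = lam k ^ s * a k ^ 2 by rw [← hab]; ring] at h1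
    nlinarith [Real.sq_sqrt h0, sq_nonneg (C - √(∑ k ∈ F, lam k ^ s * a k ^ 2))]
  have hsum2 : Summable fun k => a k ^ 2 := by
    refine Summable.of_nonneg_of_le (fun k => sq_nonneg _) (fun k => ?_) (hsum.mul_left d⁻¹)
    rw [inv_mul_eq_div, le_div_iff₀ hd, mul_comm]
    exact mul_le_mul_of_nonneg_right (hlam k) (sq_nonneg _)
  obtain ⟨w, hw⟩ := exists_coeff_eq φ hsum2
  have hwmem : w ∈ Hs lam φ s := hsum.congr fun k => by rw [hw]
  refine ⟨⟨w, hwmem⟩, LinearMap.ext fun v => ?_,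
    fun u hu => Subtype.ext (coeff_ext (φ := φ) fun k => ?_)⟩
  · change ∑' k, lam k ^ s * coeff φ w k * coeff φ v k = l v
    refine HasSum.tsum_eq ?_
    -- `l` is linear and bounded in the norm of `ℍˢ(Ω)`, so it commutes with the limit of finite
    -- sums; its values on these are the partial sums of the series.
    have h1 : Tendsto (fun F => l (basisSum lam φ s (coeff φ v) F)) atTop (𝓝 (l v)) := by
      rw [tendsto_iff_norm_sub_tendsto_zero]
      have h2 := (tendsto_hsNorm_sub_basisSum v).const_mul C
      rw [mul_zero] at h2
      refine squeeze_zero (fun _ => norm_nonneg _) (fun F => ?_) h2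
      rw [norm_sub_rev, ← map_sub]
      exact hC _
    refine h1.congr fun F => ?_
    rw [apply_basisSum]
    exact Finset.sum_congr rfl fun k _ => by beta_reduce; rw [hw, hab, mul_comm]
  · have h1 := fracPower_basis u k
    rw [hu] at h1
    rw [hw]
    exact mul_left_cancel₀ (hpos k).ne' (h1.symm.trans (hab k).symm)

/-- The control-to-state operator on `L²(Ω)`. -/
theorem exists_controlToState (hd : 0 < d) (hlam : ∀ k, d ≤ lam k ^ s) :
    ∃ S : L2 Ω →L[ℝ] L2 Ω, (∀ x y, inner ℝ (S x) y = inner ℝ x (S y)) ∧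
      (∀ z, S z ∈ Hs lam φ s) ∧
      ∀ (z : L2 Ω) (u : Hs lam φ s), IsState lam φ s (toDual lam φ s z) u ↔ (u : L2 Ω) = S z := by
  have hpos : ∀ k, 0 < lam k ^ s := fun k => hd.trans_le (hlam k)
  choose T hT hTuniq using fun z => existsUnique_isState hd hlam
    (toDual_mem_HsDual (φ := φ) hd hlam z)
  have hTc : ∀ z k, lam k ^ s * coeff φ (T z) k = coeff φ z k := fun z =>
    isState_toDual_iff.1 (hT z)
  let S₀ : L2 Ω →ₗ[ℝ] L2 Ω :=
    { toFun := fun z => T z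
      map_add' := fun y z => coeff_ext fun k => mul_left_cancel₀ (hpos k).ne' (by
        have h : ∀ v w : L2 Ω, coeff φ (v + w) k = coeff φ v k + coeff φ w k := fun v w =>
          inner_add_right _ _ _
        rw [hTc, h, h, mul_add, hTc, hTc])
      map_smul' := fun r z => coeff_ext fun k => mul_left_cancel₀ (hpos k).ne' (by
        have h : ∀ v : L2 Ω, coeff φ (r • v) k = r * coeff φ v k := fun v =>
          real_inner_smul_right _ _ _
        rw [RingHom.id_apply, hTc, h, h, mul_left_comm, hTc]) }
  have hbound : ∀ z, ‖S₀ z‖ ≤ d⁻¹ * ‖z‖ := by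
    intro z
    refine le_of_sq_le_sq ?_ (by positivity)
    rw [mul_pow, ← real_inner_self_eq_norm_sq, ← real_inner_self_eq_norm_sq]
    refine hasSum_le (fun k => ?_) (hasSum_coeff_mul φ (T z) (T z))
      ((hasSum_coeff_mul φ z z).mul_left _)
    rw [← hTc z, ← pow_two, ← pow_two, mul_pow, ← mul_assoc, ← mul_pow]
    refine le_mul_of_one_le_left (sq_nonneg _) (one_le_pow₀ ?_)
    rw [inv_mul_eq_div, one_le_div hd]
    exact hlam k
  refine ⟨S₀.mkContinuous d⁻¹ hbound, fun x y => ?_, fun z => (T z).2, fun z u => ?_⟩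
  · refine (hasSum_coeff_mul φ (T x) y).unique ?_
    have h : (fun k => coeff φ (T x) k * coeff φ y k) = fun k => coeff φ x k * coeff φ (T y) k :=
      funext fun k => by
        rw [← hTc y, ← hTc x]
        ring
    rw [h]
    exact hasSum_coeff_mul φ x (T y)
  · constructor
    · intro h
      exact congrArg Subtype.val (hTuniq z u h)
    · intro h
      rw [Subtype.ext (show (u : L2 Ω) = T z from h)]
      exact hT z

/-- As an order interval, the admissible set inherits closedness from the closed order on `L²(Ω)`.
-/
lemma Zad_eq_Icc (a b : L2 Ω) : Zad a b = Set.Icc a b := by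
  ext w
  rw [Set.mem_Icc, ← Lp.coeFn_le, ← Lp.coeFn_le]
  exact ⟨fun h => ⟨Eventually.mono h fun _ => And.left, Eventually.mono h fun _ => And.right⟩,
    fun h => h.1.and h.2⟩

end Fractional

end FracControl

/-! ### The main theorem -/

open FracControl in
theorem mainTheorem7 (n : ℕ) (hn : 1 ≤ n) (Ω : Set (EuclideanSpace ℝ (Fin n)))
    (hΩ_open : IsOpen Ω) (hΩ_bdd : Bornology.IsBounded Ω) (hΩ_conn : IsConnected Ω)
    (A : EuclideanSpace ℝ (Fin n) → Matrix (Fin n) (Fin n) ℝ)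
    (hA_lip : ∀ i j, ∃ K : NNReal, LipschitzOnWith K (fun x => A x i j) Ω)
    (hA_symm : ∀ x ∈ Ω, (A x).IsSymm)
    (hA_ell : ∃ θ : ℝ, 0 < θ ∧ ∀ x ∈ Ω, ∀ ξ : Fin n → ℝ,
      θ * (ξ ⬝ᵥ ξ) ≤ ξ ⬝ᵥ ((A x).mulVec ξ))
    (c : EuclideanSpace ℝ (Fin n) → ℝ)
    (hc : MemLp c ⊤ (volume.restrict Ω)) (hc_nonneg : ∀ᵐ x ∂(volume.restrict Ω), 0 ≤ c x)
    (s : ℝ) (hs : s ∈ Set.Ioo (0 : ℝ) 1) (μ : ℝ) (hμ : 0 < μ)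
    (ud a b : L2 Ω) (hab : ∀ᵐ x ∂(volume.restrict Ω), a x ≤ b x) :
    -- the Dirichlet eigenfunctions of the elliptic operator provide an orthonormal basis
    (∃ (lam : ℕ → ℝ) (φ : HilbertBasis ℕ ℝ (L2 Ω)), IsEigenbasis A c lam φ) ∧
    -- and, whichever such basis is used to define the fractional power,
    ∀ (lam : ℕ → ℝ) (φ : HilbertBasis ℕ ℝ (L2 Ω)), IsEigenbasis A c lam φ →
      -- the control-to-state operator is well defined on the dual space, which contains `L²(Ω)`,
      (∀ l ∈ HsDual lam φ s, ∃! u : Hs lam φ s, IsState lam φ s l u) ∧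
      (∀ z : L2 Ω, toDual lam φ s z ∈ HsDual lam φ s) ∧
      -- there is exactly one optimal pair,
      (∃! q : Hs lam φ s × L2 Ω, IsOptimalPair lam φ s μ ud a b q.1 q.2) ∧
      -- and the optimality conditions are necessary and sufficient.
      (∀ (u : Hs lam φ s) (z : L2 Ω), IsOptimalPair lam φ s μ ud a b u z ↔
        IsState lam φ s (toDual lam φ s z) u ∧
        ∃ p : Hs lam φ s, IsState lam φ s (toDual lam φ s ((u : L2 Ω) - ud)) p ∧
          z ∈ Zad a b ∧
          ∀ z' ∈ Zad a b, 0 ≤ inner ℝ (μ • z + (p : L2 Ω)) (z' - z)) := by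
  obtain ⟨θ, hθ, hA⟩ := hA_ell
  refine ⟨exists_isEigenbasis hn hΩ_open hΩ_bdd hΩ_conn.nonempty hA_lip hA_symm hθ hA hc
    hc_nonneg, fun lam φ hφ => ?_⟩
  obtain ⟨m, hm, hbound⟩ := exists_eigenvalue_lower_bound hn hΩ_open hΩ_bdd hA_lip hθ hA hc
    hc_nonneg
  -- Since `s > 0`, the lower bound `m` for the eigenvalues passes to their powers; the rest uses
  -- only this bound and the basis.
  have hd : 0 < m ^ s := Real.rpow_pos_of_pos hm s
  have hlam : ∀ k, m ^ s ≤ lam k ^ s := fun k =>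
    Real.rpow_le_rpow hm.le (hbound lam φ hφ k) hs.1.le
  obtain ⟨S, hS, hSmem, hSstate⟩ := exists_controlToState (φ := φ) hd hlam
  have hZ : Convex ℝ (Zad a b) := by
    intro v hv w hw r t hr ht hrt
    filter_upwards [hv, hw, Lp.coeFn_add (r • v) (t • w), Lp.coeFn_smul r v, Lp.coeFn_smul t w]
      with x h1 h2 h3 h4 h5
    rw [h3, Pi.add_apply, h4, h5, Pi.smul_apply, Pi.smul_apply]
    exact convex_Icc (a x) (b x) h1 h2 hr ht hrt
  have hcl : IsClosed (Zad a b) := by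
    rw [Zad_eq_Icc]
    exact isClosed_Icc
  have hne : (Zad a b).Nonempty := ⟨a, by filter_upwards [hab] with x hx using ⟨le_rfl, hx⟩⟩
  -- The state is eliminated: optimality of the pair becomes minimality of the reduced cost, hence a
  -- variational inequality in `z` alone.
  have hopt : ∀ (u : Hs lam φ s) (z : L2 Ω), IsOptimalPair lam φ s μ ud a b u z ↔
      (u : L2 Ω) = S z ∧ z ∈ Zad a b ∧
        ∀ z' ∈ Zad a b, 0 ≤ inner ℝ (μ • z + S (S z - ud)) (z' - z) := by
    intro u z
    rw [IsOptimalPair, hSstate]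
    constructor
    · rintro ⟨hz, hu, hmin⟩
      refine ⟨hu, hz, (isMinOn_trackingCost_iff hS hμ ud hZ hz).1 fun z' hz' => ?_⟩
      have := hmin ⟨S z', hSmem z'⟩ z' hz' ((hSstate _ _).2 rfl)
      rwa [hu] at this
    · rintro ⟨hu, hz, hvi⟩
      refine ⟨hz, hu, fun u' z' hz' hu' => ?_⟩
      rw [hu, (hSstate _ _).1 hu']
      exact (isMinOn_trackingCost_iff hS hμ ud hZ hz).2 hvi z' hz'
  refine ⟨fun l hl => existsUnique_isState hd hlam hl, toDual_mem_HsDual hd hlam, ?_,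
    fun u z => ?_⟩
  · obtain ⟨z, hz, hmin⟩ := exists_isMinOn_trackingCost S hμ ud hne hcl hZ
    have hvi := (isMinOn_trackingCost_iff hS hμ ud hZ hz).1 hmin
    refine ⟨(⟨S z, hSmem z⟩, z), (hopt _ _).2 ⟨rfl, hz, hvi⟩, ?_⟩
    rintro ⟨u, y⟩ hy
    obtain ⟨hu, hyZ, hyvi⟩ := (hopt u y).1 hy
    have h : y = z := eq_of_variationalInequality hS hμ ud (hyvi z hz) (hvi y hyZ)
    subst h
    exact Prod.ext (Subtype.ext hu) rfl
  · rw [hopt, hSstate]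
    refine and_congr_right fun hu => ?_
    constructor
    · rintro ⟨hz, hvi⟩
      -- The adjoint state: since `S` is self-adjoint, the term `S (S z - ud)` of the gradient again
      -- solves the state equation, with right-hand side `u - ud`.
      refine ⟨⟨S (u - ud), hSmem _⟩, (hSstate _ _).2 rfl, hz, ?_⟩
      simpa only [hu] using hvi
    · rintro ⟨p, hp, hz, hvi⟩
      rw [hSstate] at hp
      rw [hp, hu] at hvi
      exact ⟨hz, hvi⟩
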